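/- Let $\Bbbk$ be a field. Let $\mathcal C,\mathcal D$ be $\Bbbk$-linear abelian categories with $\Bbbk$-bilinear monoidal products, where $\mathcal C$ is finite ($\Bbbk$-linearly equivalent to the category of finite-dimensional modules over a finite-dimensional $\Bbbk$-algebra) and rigid (all objects have left and right duals), and $\otimes_{\mathcal D}$ is right exact in each variable. Let $F:\mathcal C\to\mathcal D$ be a $\Bbbk$-linear, right exact (strong) monoidal functor with monoidal structure $F^{(2)}_{X,Y}:F(X)\otimes F(Y)\xrightarrow{\sim}F(X\otimes Y)$, and assume that $F$ has a right adjoint $R$. (Associativity and unit isomorphisms are suppressed below.) The centralizer $\mathcal Z(F)$ has as objects the pairs $\mathsf V=(V,\rho)$ of $V\in\mathcal D$ and a natural isomorphism $\rho_X:V\otimes F(X)\xrightarrow{\sim}F(X)\otimes V$ with $$\rho_{X\otimes Y}\circ(\mathrm{id}_V\otimes F^{(2)}_{X,Y})=(F^{(2)}_{X,Y}\otimes\mathrm{id}_V)\circ(\mathrm{id}_{F(X)}\otimes\rho_Y)\circ(\rho_X\otimes\mathrm{id}_{F(Y)}),$$ and as morphisms the morphisms of $\mathcal D$ that commute with the half-braidings;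 $\boldsymbol 1\in\mathcal Z(F)$ is the unit object with its canonical half-braiding, and $\mathcal Z(\mathcal C)=\mathcal Z(\mathrm{Id}_{\mathcal C})$. Let $\widetilde F:\mathcal Z(\mathcal C)\to\mathcal Z(F)$ be the functor $(V,\rho)\mapsto\bigl(F(V),\,(F^{(2)}_{X,V})^{-1}\circ F(\rho_X)\circ F^{(2)}_{V,X}\bigr)$, $f\mapsto F(f)$. For $\mathsf V=(V,\rho^V)$ and $\mathsf W=(W,\rho^W)$ in $\mathcal Z(F)$, let $C^n_{\mathrm{DY}}(F;\mathsf V,\mathsf W)$ be the space of natural transformations $f_{X_1,\dots,X_n}:V\otimes F(X_1)\otimes\dots\otimes F(X_n)\to F(X_1\otimes\dots\otimes X_n)\otimes W$, with differential $\delta^n=\sum_{i=0}^{n+1}(-1)^i\partial^n_i$, where \begin{align*} \partial^n_0(f)_{X_1,\dots,X_{n+1}}&=(F^{(2)}_{X_1,X_2\otimes\dots\otimes X_{n+1}}\otimes\mathrm{id}_W)\circ(\mathrm{id}_{F(X_1)}\otimes f_{X_2,\dots,X_{n+1}})\circ(\rho^V_{X_1}\otimes\mathrm{id}),\\ \partial^n_i(f)_{X_1,\dots,X_{n+1}}&=f_{X_1,\dots,X_i\otimes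 X_{i+1},\dots,X_{n+1}}\circ(\mathrm{id}\otimes F^{(2)}_{X_i,X_{i+1}}\otimes\mathrm{id})\qquad(1\le i\le n),\\ \partial^n_{n+1}(f)_{X_1,\dots,X_{n+1}}&=(F^{(2)}_{X_1\otimes\dots\otimes X_n,X_{n+1}}\otimes\mathrm{id}_W)\circ(\mathrm{id}\otimes\rho^W_{X_{n+1}})\circ(f_{X_1,\dots,X_n}\otimes\mathrm{id}_{F(X_{n+1})}). \end{align*} Let $H^n_{\mathrm{DY}}(F;\mathsf V,\mathsf W)=\ker\delta^n/\operatorname{im}\delta^{n-1}$. Let $H^n_{\mathrm{DY}}(F)$ be the cohomology of the complex of natural transformations $F(X_1)\otimes\dots\otimes F(X_n)\to F(X_1\otimes\dots\otimes X_n)$ with the same differential, omitting $V,W,\rho^V,\rho^W$. Then the adjunction $F\dashv R$ lifts to the centralizers: $\widetilde F$ has a right adjoint $\widetilde R:\mathcal Z(F)\to\mathcal Z(\mathcal C)$ which, compatibly with units and counits, is $R$ on underlying objects and morphisms. For this $\widetilde R$ (indeed for any right adjoint $\widetilde R$ of $\widetilde F$), for all $\mathsf V\in\mathcal Z(\mathcal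 C)$, $\mathsf W\in\mathcal Z(F)$ and $n\ge0$ there is an isomorphism of $\Bbbk$-vector spaces $$H^n_{\mathrm{DY}}\bigl(F;\widetilde F(\mathsf V),\mathsf W\bigr)\cong H^n_{\mathrm{DY}}\bigl(\mathrm{Id}_{\mathcal C};\mathsf V,\widetilde R(\mathsf W)\bigr),$$ and in particular, for all $n\ge0$, $$H^n_{\mathrm{DY}}(F)\cong H^n_{\mathrm{DY}}\bigl(\mathrm{Id}_{\mathcal C};\boldsymbol 1,\widetilde R(\boldsymbol 1)\bigr).$$ -/

import Mathlib

open CategoryTheory MonoidalCategory Limits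

universe w v₁ v₂ u₁ u₂

noncomputable section

namespace DavydovYetter

open Functor.LaxMonoidal Functor.OplaxMonoidal

/-! ### Finite linear categories -/

/-- A `k`-linear category is finite if it is `k`-linearly equivalent to the category of
finite-dimensional modules over a finite-dimensional `k`-algebra `A`.  Over such an `A`, a module
is finite-dimensional over `k` if and only if it is finitely generated over `A`. -/
def IsFiniteLinearCategory (k : Type w) [Field k] (C : Type u₁) [Category.{v₁} C]
    [Preadditive C] [Linear k C] : Prop :=
  ∃ (A : Type w) (_ : Ring A) (_ : Algebra k A) (_ : Module.Finite k A)
    (e : C ≌ FGModuleCat.{w} A), e.functor.Additive ∧ e.functor.Linear k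

/-! ### Tuples of objects and their tensor products -/

section Tuples

variable (C : Type u₁)

/-- `Tuple C n` is the type of `n`-tuples `(X₁, (X₂, (… , (Xₙ, *))))` of objects of `C`. -/
@[reducible]
def Tuple : ℕ → Type u₁
  | 0 => PUnit.{u₁ + 1}
  | n + 1 => C × Tuple n

variable {C}

/-- The first `n` entries of an `(n+1)`-tuple. -/
@[reducible]
def Tuple.init : {n : ℕ} → Tuple C (n + 1) → Tuple C n
  | 0, _ => PUnit.unit
  | _ + 1, L => (L.1, Tuple.init L.2)

/-- The last entry of an `(n+1)`-tuple. -/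
@[reducible]
def Tuple.last : {n : ℕ} → Tuple C (n + 1) → C
  | 0, L => L.1
  | _ + 1, L => Tuple.last L.2

variable [Category.{v₁} C]

/-- A morphism of `n`-tuples is an `n`-tuple of morphisms. -/
@[reducible]
def Tuple.Hom : {n : ℕ} → Tuple C n → Tuple C n → Type v₁
  | 0, _, _ => PUnit.{v₁ + 1}
  | _ + 1, L, M => (L.1 ⟶ M.1) × Tuple.Hom L.2 M.2

def Tuple.Hom.init : {n : ℕ} → {L M : Tuple C (n + 1)} → Tuple.Hom L M →
    Tuple.Hom (Tuple.init L) (Tuple.init M)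
  | 0, _, _, _ => PUnit.unit
  | _ + 1, _, _, φ => (φ.1, Tuple.Hom.init φ.2)

def Tuple.Hom.last : {n : ℕ} → {L M : Tuple C (n + 1)} → Tuple.Hom L M →
    (Tuple.last L ⟶ Tuple.last M)
  | 0, _, _, φ => φ.1
  | n + 1, L, M, φ => Tuple.Hom.last (n := n) (L := L.2) (M := M.2) φ.2

def Tuple.Hom.id : {n : ℕ} → (L : Tuple C n) → Tuple.Hom L L
  | 0, _ => PUnit.unit
  | _ + 1, L => (𝟙 L.1, Tuple.Hom.id L.2)

def Tuple.Hom.comp : {n : ℕ} → {L M N : Tuple C n} → Tuple.Hom L M → Tuple.Hom M N →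
    Tuple.Hom L N
  | 0, _, _, _, _, _ => PUnit.unit
  | _ + 1, _, _, _, φ, ψ => (φ.1 ≫ ψ.1, Tuple.Hom.comp φ.2 ψ.2)

theorem Tuple.Hom.id_comp : ∀ {n : ℕ} {L M : Tuple C n} (φ : Tuple.Hom L M),
    (Tuple.Hom.id L).comp φ = φ
  | 0, _, _, _ => rfl
  | _ + 1, _, _, φ => Prod.ext (Category.id_comp φ.1) (Tuple.Hom.id_comp φ.2)

theorem Tuple.Hom.comp_id : ∀ {n : ℕ} {L M : Tuple C n} (φ : Tuple.Hom L M),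
    φ.comp (Tuple.Hom.id M) = φ
  | 0, _, _, _ => rfl
  | _ + 1, _, _, φ => Prod.ext (Category.comp_id φ.1) (Tuple.Hom.comp_id φ.2)

variable [MonoidalCategory C]

/-- `tens (X₁, …, Xₙ) = X₁ ⊗ (X₂ ⊗ (… ⊗ (Xₙ ⊗ 𝟙)))`. -/
@[reducible]
def tens : {n : ℕ} → Tuple C n → C
  | 0, _ => 𝟙_ C
  | _ + 1, L => L.1 ⊗ tens L.2

def tensMap : {n : ℕ} → {L M : Tuple C n} → Tuple.Hom L M → (tens L ⟶ tens M)
  | 0, _, _, _ => 𝟙 (𝟙_ C)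
  | _ + 1, _, _, φ => φ.1 ⊗ₘ tensMap φ.2

/-- `merge j (X₁, …, Xₙ₊₁) = (X₁, …, Xᵢ ⊗ Xᵢ₊₁, …, Xₙ₊₁)` with `i = j + 1`, for `0 ≤ j < n`. -/
@[reducible]
def merge : {n : ℕ} → Fin n → Tuple C (n + 1) → Tuple C n
  | n + 1, ⟨0, _⟩, L => ((L.1 ⊗ L.2.1, L.2.2) : C × Tuple C n)
  | n + 1, ⟨j + 1, h⟩, L =>
    ((L.1, merge ⟨j, Nat.lt_of_succ_lt_succ h⟩ L.2) : C × Tuple C n)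

def mergeHom : {n : ℕ} → (j : Fin n) → {L M : Tuple C (n + 1)} → Tuple.Hom L M →
    Tuple.Hom (merge j L) (merge j M)
  | _ + 1, ⟨0, _⟩, _, _, φ => (φ.1 ⊗ₘ φ.2.1, φ.2.2)
  | _ + 1, ⟨j + 1, h⟩, _, _, φ => (φ.1, mergeHom ⟨j, Nat.lt_of_succ_lt_succ h⟩ φ.2)

/-- The associativity isomorphism from the tensor product of a merged tuple to the tensor product
of the tuple (an identity when `C` is strict). -/
def tensMerge : {n : ℕ} → (j : Fin n) → (L : Tuple C (n + 1)) → (tens (merge j L) ⟶ tens L)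
  | _ + 1, ⟨0, _⟩, L => (α_ L.1 L.2.1 (tens L.2.2)).hom
  | _ + 1, ⟨j + 1, h⟩, L => L.1 ◁ tensMerge ⟨j, Nat.lt_of_succ_lt_succ h⟩ L.2

/-- The associativity isomorphism `(X₁ ⊗ … ⊗ Xₙ) ⊗ Xₙ₊₁ ⟶ X₁ ⊗ … ⊗ Xₙ₊₁` (an identity when `C` is
strict). -/
def tensSnoc : {n : ℕ} → (L : Tuple C (n + 1)) →
    (tens (Tuple.init L) ⊗ Tuple.last L ⟶ tens L)
  | 0, L => (λ_ L.1).hom ≫ (ρ_ L.1).inv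
  | _ + 1, L => (α_ L.1 (tens (Tuple.init L.2)) (Tuple.last L.2)).hom ≫ L.1 ◁ tensSnoc L.2

theorem tensMerge_naturality : ∀ {n : ℕ} (j : Fin n) {L M : Tuple C (n + 1)}
    (φ : Tuple.Hom L M),
    tensMap (mergeHom j φ) ≫ tensMerge j M = tensMerge j L ≫ tensMap φ
  | _ + 1, ⟨0, _⟩, _, _, φ => by
    exact associator_naturality φ.1 φ.2.1 (tensMap φ.2.2)
  | _ + 1, ⟨j + 1, h⟩, L, M, φ => by
    have ih := tensMerge_naturality ⟨j, Nat.lt_of_succ_lt_succ h⟩ φ.2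
    change (φ.1 ⊗ₘ tensMap (mergeHom ⟨j, _⟩ φ.2)) ≫ M.1 ◁ tensMerge ⟨j, _⟩ M.2 =
      L.1 ◁ tensMerge ⟨j, _⟩ L.2 ≫ (φ.1 ⊗ₘ tensMap φ.2)
    rw [MonoidalCategory.tensorHom_def, Category.assoc, ← whiskerLeft_comp, ih, whiskerLeft_comp,
      ← whisker_exchange_assoc, ← MonoidalCategory.tensorHom_def]

theorem tensSnoc_naturality : ∀ {n : ℕ} {L M : Tuple C (n + 1)} (φ : Tuple.Hom L M),
    (tensMap φ.init ⊗ₘ φ.last) ≫ tensSnoc M = tensSnoc L ≫ tensMap φ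
  | 0, L, M, φ => by
    change (𝟙 (𝟙_ C) ⊗ₘ φ.1) ≫ (λ_ M.1).hom ≫ (ρ_ M.1).inv =
      ((λ_ L.1).hom ≫ (ρ_ L.1).inv) ≫ (φ.1 ⊗ₘ 𝟙 (𝟙_ C))
    simp
  | _ + 1, L, M, φ => by
    have ih := tensSnoc_naturality φ.2
    change ((φ.1 ⊗ₘ tensMap (Tuple.Hom.init φ.2)) ⊗ₘ Tuple.Hom.last φ.2) ≫
        (α_ M.1 (tens (Tuple.init M.2)) (Tuple.last M.2)).hom ≫ M.1 ◁ tensSnoc M.2 =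
      ((α_ L.1 (tens (Tuple.init L.2)) (Tuple.last L.2)).hom ≫ L.1 ◁ tensSnoc L.2) ≫
        (φ.1 ⊗ₘ tensMap φ.2)
    rw [associator_naturality_assoc, Category.assoc, MonoidalCategory.tensorHom_def φ.1 (tensMap φ.2),
      whisker_exchange_assoc, ← whiskerLeft_comp, ← ih, MonoidalCategory.tensorHom_def, Category.assoc,
      ← whiskerLeft_comp]

end Tuples

/-! ### The centralizer of a monoidal functor -/

section Centralizer

variable {C : Type u₁} [Category.{v₁} C] [MonoidalCategory C]
  {D : Type u₂} [Category.{v₂} D] [MonoidalCategory D]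

/-- Objects of the centralizer `𝒵(F)`: pairs `(V, ρ)` of an object `V` of `D` and a half-braiding
`ρ : V ⊗ F(-) ≅ F(-) ⊗ V` relative to `F`. For `F = 𝟭 C` this is the Drinfeld center of `C`. -/
structure Centralizer (F : C ⥤ D) [F.Monoidal] where
  obj : D
  braid : ∀ X : C, obj ⊗ F.obj X ≅ F.obj X ⊗ obj
  naturality : ∀ {X Y : C} (f : X ⟶ Y),
    obj ◁ F.map f ≫ (braid Y).hom = (braid X).hom ≫ F.map f ▷ obj
  hexagon : ∀ X Y : C,
    obj ◁ μ F X Y ≫ (braid (X ⊗ Y)).hom =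
      (α_ obj (F.obj X) (F.obj Y)).inv ≫ (braid X).hom ▷ F.obj Y ≫
        (α_ (F.obj X) obj (F.obj Y)).hom ≫ F.obj X ◁ (braid Y).hom ≫
          (α_ (F.obj X) (F.obj Y) obj).inv ≫ μ F X Y ▷ obj

namespace Centralizer

variable {F : C ⥤ D} [F.Monoidal]

/-- Morphisms of `𝒵(F)`: morphisms in `D` commuting with the half-braidings. -/
@[ext]
structure Hom (V W : Centralizer F) where
  hom : V.obj ⟶ W.obj
  comm : ∀ X : C, hom ▷ F.obj X ≫ (W.braid X).hom = (V.braid X).hom ≫ F.obj X ◁ hom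

instance : Category (Centralizer F) where
  Hom V W := Hom V W
  id V := { hom := 𝟙 V.obj, comm := fun X => by simp }
  comp f g :=
    { hom := f.hom ≫ g.hom
      comm := fun X => by
        rw [comp_whiskerRight, Category.assoc, g.comm, ← Category.assoc, f.comm, Category.assoc,
          ← whiskerLeft_comp] }

@[simp] theorem id_hom (V : Centralizer F) : Hom.hom (𝟙 V) = 𝟙 V.obj := rfl

@[simp] theorem comp_hom {V W U : Centralizer F} (f : V ⟶ W) (g : W ⟶ U) :
    Hom.hom (f ≫ g) = Hom.hom f ≫ Hom.hom g := rfl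

variable (F)

/-- The forgetful functor `𝒵(F) ⥤ D`. -/
def forget : Centralizer F ⥤ D where
  obj V := V.obj
  map f := Hom.hom f

/-- The tensor unit of `𝒵(F)`. -/
def unit : Centralizer F where
  obj := 𝟙_ D
  braid X := λ_ (F.obj X) ≪≫ (ρ_ (F.obj X)).symm
  naturality f := by
    simp only [Iso.trans_hom, Iso.symm_hom, Category.assoc]
    rw [MonoidalCategory.leftUnitor_naturality_assoc,
      MonoidalCategory.rightUnitor_inv_naturality]
  hexagon X Y := by
    simp only [Iso.trans_hom, Iso.symm_hom, MonoidalCategory.rightUnitor_inv_naturality]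
    monoidal

theorem lift_hexagon
    {V X Y : C} (b : V ⊗ X ⟶ X ⊗ V) (c : V ⊗ Y ⟶ Y ⊗ V) :
    F.obj V ◁ μ F X Y ≫ μ F V (X ⊗ Y) ≫
        F.map ((α_ V X Y).inv ≫ b ▷ Y ≫ (α_ X V Y).hom ≫ X ◁ c ≫ (α_ X Y V).inv) ≫
          δ F (X ⊗ Y) V =
      (α_ (F.obj V) (F.obj X) (F.obj Y)).inv ≫ (μ F V X ≫ F.map b ≫ δ F X V) ▷ F.obj Y ≫
        (α_ (F.obj X) (F.obj V) (F.obj Y)).hom ≫ F.obj X ◁ (μ F V Y ≫ F.map c ≫ δ F Y V) ≫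
          (α_ (F.obj X) (F.obj Y) (F.obj V)).inv ≫ μ F X Y ▷ F.obj V := by
  rw [← cancel_mono (μ F (X ⊗ Y) V), ← cancel_epi (α_ (F.obj V) (F.obj X) (F.obj Y)).hom]
  simp only [Category.assoc, Functor.Monoidal.δ_μ, Category.comp_id, Iso.hom_inv_id_assoc,
    F.map_comp, comp_whiskerRight, MonoidalCategory.whiskerLeft_comp]
  rw [← Functor.LaxMonoidal.associativity_inv F X Y V,
    Functor.Monoidal.whiskerLeft_δ_μ_assoc, μ_natural_right_assoc,
    ← Functor.LaxMonoidal.associativity_assoc, ← Functor.LaxMonoidal.associativity_assoc,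
    Functor.Monoidal.whiskerRight_δ_μ_assoc, μ_natural_left_assoc,
    ← F.map_comp_assoc (α_ V X Y).hom, Iso.hom_inv_id, F.map_id, Category.id_comp]
theorem lift_comm {V W X : C}
    (f : V ⟶ W) (b : V ⊗ X ⟶ X ⊗ V) (c : W ⊗ X ⟶ X ⊗ W) (h : f ▷ X ≫ c = b ≫ X ◁ f) :
    F.map f ▷ F.obj X ≫ μ F W X ≫ F.map c ≫ δ F X W =
      (μ F V X ≫ F.map b ≫ δ F X V) ≫ F.obj X ◁ F.map f := by
  simp only [Category.assoc, μ_natural_left_assoc, δ_natural_right, ← F.map_comp_assoc, h]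

/-- The lift `F̃ : 𝒵(C) ⥤ 𝒵(F)` of `F`, sending `(V, ρ)` to `F(V)` with the half-braiding
`F(V) ⊗ F(X) ≅ F(V ⊗ X) ≅ F(X ⊗ V) ≅ F(X) ⊗ F(V)`. -/
def lift : Centralizer (𝟭 C) ⥤ Centralizer F where
  obj V :=
    { obj := F.obj V.obj
      braid := fun X => Functor.Monoidal.μIso F V.obj X ≪≫ F.mapIso (V.braid X) ≪≫
        (Functor.Monoidal.μIso F X V.obj).symm
      naturality := fun {X Y} f => by
        have h : V.obj ◁ f ≫ (V.braid Y).hom = (V.braid X).hom ≫ f ▷ V.obj := V.naturality f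
        change F.obj V.obj ◁ F.map f ≫ μ F V.obj Y ≫ F.map (V.braid Y).hom ≫ δ F Y V.obj =
          (μ F V.obj X ≫ F.map (V.braid X).hom ≫ δ F X V.obj) ≫ F.map f ▷ F.obj V.obj
        simp only [Category.assoc, μ_natural_right_assoc, δ_natural_left]
        rw [← F.map_comp_assoc, ← F.map_comp_assoc]
        exact congrArg (fun g => μ F V.obj X ≫ F.map g ≫ δ F Y V.obj) h
      hexagon := fun X Y => by
        have h : (V.braid (X ⊗ Y)).hom = (α_ V.obj X Y).inv ≫ (V.braid X).hom ▷ Y ≫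
            (α_ X V.obj Y).hom ≫ X ◁ (V.braid Y).hom ≫ (α_ X Y V.obj).inv := by
          simpa using V.hexagon X Y
        have h' := lift_hexagon F (V := V.obj) (X := X) (Y := Y)
          (V.braid X).hom (V.braid Y).hom
        rw [← h] at h'
        exact h' }
  map {V W} f :=
    { hom := F.map (Hom.hom f)
      comm := fun X => lift_comm F (Hom.hom f) (V.braid X).hom (W.braid X).hom (f.comm X) }
  map_id V := by
    apply Hom.ext
    exact F.map_id V.obj
  map_comp f g := by
    apply Hom.ext
    exact F.map_comp (Hom.hom f) (Hom.hom g)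

end Centralizer

/-- An adjunction `F̃ ⊣ R'` between `𝒵(C)` and `𝒵(F)` lifts the adjunction `F ⊣ R` if `R'` is given
by `R` on underlying objects and morphisms, and the unit and counit of `F̃ ⊣ R'` are those of
`F ⊣ R`, up to the identification `e` of the underlying objects. -/
def IsLiftedAdjunction {F : C ⥤ D} [F.Monoidal] {R : D ⥤ C} (adj : F ⊣ R)
    {R' : Centralizer F ⥤ Centralizer (𝟭 C)} (adj' : Centralizer.lift F ⊣ R') : Prop :=
  ∃ e : R' ⋙ Centralizer.forget (𝟭 C) ≅ Centralizer.forget F ⋙ R,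
    (∀ V : Centralizer (𝟭 C),
      (adj'.unit.app V).hom ≫ e.hom.app ((Centralizer.lift F).obj V) = adj.unit.app V.obj) ∧
    (∀ W : Centralizer F,
      (adj'.counit.app W).hom = F.map (e.hom.app W) ≫ adj.counit.app W.obj)

end Centralizer

/-! ### Multivariable natural transformations -/

section Source

variable {C : Type u₁} [Category.{v₁} C]
  {D : Type u₂} [Category.{v₂} D] [MonoidalCategory D] (F : C ⥤ D)

/-- `src F V (X₁, …, Xₙ) = ((V ⊗ F(X₁)) ⊗ F(X₂)) ⊗ … ⊗ F(Xₙ)`. -/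
@[reducible]
def src : {n : ℕ} → D → Tuple C n → D
  | 0, V, _ => V
  | _ + 1, V, L => src (V ⊗ F.obj L.1) L.2

def srcMap : {n : ℕ} → {V W : D} → (V ⟶ W) → {L M : Tuple C n} → Tuple.Hom L M →
    (src F V L ⟶ src F W M)
  | 0, _, _, a, _, _, _ => a
  | _ + 1, _, _, a, _, _, φ => srcMap (a ⊗ₘ F.map φ.1) φ.2

theorem srcMap_comp : ∀ {n : ℕ} {U V W : D} (a : U ⟶ V) (b : V ⟶ W) {L M N : Tuple C n}
    (φ : Tuple.Hom L M) (ψ : Tuple.Hom M N),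
    srcMap F a φ ≫ srcMap F b ψ = srcMap F (a ≫ b) (φ.comp ψ)
  | 0, _, _, _, _, _, _, _, _, _, _ => rfl
  | _ + 1, _, _, _, a, b, _, _, _, φ, ψ => by
    refine (srcMap_comp (a ⊗ₘ F.map φ.1) (b ⊗ₘ F.map ψ.1) φ.2 ψ.2).trans ?_
    rw [tensorHom_comp_tensorHom, ← F.map_comp]
    rfl

/-- The associativity isomorphism
`(A ⊗ V) ⊗ F(X₁) ⊗ … ⊗ F(Xₙ) ⟶ A ⊗ (V ⊗ F(X₁) ⊗ … ⊗ F(Xₙ))` (an identity when `D` is strict). -/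
def srcPull : {n : ℕ} → (A V : D) → (L : Tuple C n) → (src F (A ⊗ V) L ⟶ A ⊗ src F V L)
  | 0, A, V, _ => 𝟙 (A ⊗ V)
  | _ + 1, A, V, L =>
    srcMap F (α_ A V (F.obj L.1)).hom (Tuple.Hom.id L.2) ≫ srcPull A (V ⊗ F.obj L.1) L.2

theorem srcPull_naturality : ∀ {n : ℕ} {A B V W : D} (c : A ⟶ B) (a : V ⟶ W)
    {L M : Tuple C n} (φ : Tuple.Hom L M),
    srcMap F (c ⊗ₘ a) φ ≫ srcPull F B W M = srcPull F A V L ≫ (c ⊗ₘ srcMap F a φ)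
  | 0, A, B, V, W, c, a, _, _, _ => by
    change (c ⊗ₘ a) ≫ 𝟙 _ = 𝟙 _ ≫ (c ⊗ₘ a)
    rw [Category.comp_id, Category.id_comp]
  | _ + 1, A, B, V, W, c, a, L, M, φ => by
    have ih := srcPull_naturality c (a ⊗ₘ F.map φ.1) φ.2
    change srcMap F ((c ⊗ₘ a) ⊗ₘ F.map φ.1) φ.2 ≫
        srcMap F (α_ B W (F.obj M.1)).hom (Tuple.Hom.id M.2) ≫
          srcPull F B (W ⊗ F.obj M.1) M.2 =
      (srcMap F (α_ A V (F.obj L.1)).hom (Tuple.Hom.id L.2) ≫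
        srcPull F A (V ⊗ F.obj L.1) L.2) ≫ (c ⊗ₘ srcMap F (a ⊗ₘ F.map φ.1) φ.2)
    rw [Category.assoc, ← ih, ← Category.assoc, srcMap_comp, ← Category.assoc, srcMap_comp,
      associator_naturality, Tuple.Hom.id_comp, Tuple.Hom.comp_id]

/-- The last factor `F(Xₙ₊₁)` of `V ⊗ F(X₁) ⊗ … ⊗ F(Xₙ₊₁)` split off. With the chosen bracketing
this is an identity. -/
def srcSnoc : {n : ℕ} → (V : D) → (L : Tuple C (n + 1)) →
    (src F V L ⟶ src F V (Tuple.init L) ⊗ F.obj (Tuple.last L))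
  | 0, V, L => 𝟙 (V ⊗ F.obj L.1)
  | _ + 1, V, L => srcSnoc (V ⊗ F.obj L.1) L.2

theorem srcSnoc_naturality : ∀ {n : ℕ} {V W : D} (a : V ⟶ W) {L M : Tuple C (n + 1)}
    (φ : Tuple.Hom L M),
    srcMap F a φ ≫ srcSnoc F W M = srcSnoc F V L ≫ (srcMap F a φ.init ⊗ₘ F.map φ.last)
  | 0, V, W, a, L, M, φ => by
    change (a ⊗ₘ F.map φ.1) ≫ 𝟙 _ = 𝟙 _ ≫ (a ⊗ₘ F.map φ.1)
    rw [Category.comp_id, Category.id_comp]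
  | _ + 1, _, _, a, _, _, φ => srcSnoc_naturality (a ⊗ₘ F.map φ.1) φ.2

variable [MonoidalCategory C] [F.Monoidal]

/-- The monoidal structure of `F` applied to the factors `F(Xᵢ) ⊗ F(Xᵢ₊₁)`, where `i = j + 1`. -/
def srcMerge : {n : ℕ} → (j : Fin n) → (V : D) → (L : Tuple C (n + 1)) →
    (src F V L ⟶ src F V (merge j L))
  | _ + 1, ⟨0, _⟩, V, L =>
    srcMap F ((α_ V (F.obj L.1) (F.obj L.2.1)).hom ≫ V ◁ μ F L.1 L.2.1) (Tuple.Hom.id L.2.2)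
  | _ + 1, ⟨j + 1, h⟩, V, L => srcMerge ⟨j, Nat.lt_of_succ_lt_succ h⟩ (V ⊗ F.obj L.1) L.2

theorem srcMerge_naturality : ∀ {n : ℕ} (j : Fin n) {V W : D} (a : V ⟶ W)
    {L M : Tuple C (n + 1)} (φ : Tuple.Hom L M),
    srcMap F a φ ≫ srcMerge F j W M = srcMerge F j V L ≫ srcMap F a (mergeHom j φ)
  | _ + 1, ⟨0, _⟩, V, W, a, L, M, φ => by
    change srcMap F ((a ⊗ₘ F.map φ.1) ⊗ₘ F.map φ.2.1) φ.2.2 ≫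
        srcMap F ((α_ W (F.obj M.1) (F.obj M.2.1)).hom ≫ W ◁ μ F M.1 M.2.1)
          (Tuple.Hom.id M.2.2) =
      srcMap F ((α_ V (F.obj L.1) (F.obj L.2.1)).hom ≫ V ◁ μ F L.1 L.2.1)
          (Tuple.Hom.id L.2.2) ≫
        srcMap F (a ⊗ₘ F.map (φ.1 ⊗ₘ φ.2.1)) φ.2.2
    rw [srcMap_comp, srcMap_comp, Tuple.Hom.id_comp, Tuple.Hom.comp_id,
      associator_naturality_assoc, Category.assoc]
    congr 2
    rw [← id_tensorHom, ← id_tensorHom, tensorHom_comp_tensorHom, tensorHom_comp_tensorHom,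
      Category.comp_id, Category.id_comp, μ_natural]
  | _ + 1, ⟨j + 1, h⟩, _, _, a, _, _, φ =>
    srcMerge_naturality ⟨j, Nat.lt_of_succ_lt_succ h⟩ (a ⊗ₘ F.map φ.1) φ.2

end Source

section Cochains

variable (k : Type w) [Field k]
  {C : Type u₁} [Category.{v₁} C] [MonoidalCategory C]
  {D : Type u₂} [Category.{v₂} D] [MonoidalCategory D] [Preadditive D] [Linear k D]
  (F : C ⥤ D)

/-- The `k`-vector space of natural transformations
`V ⊗ F(X₁) ⊗ … ⊗ F(Xₙ) ⟶ G(X₁ ⊗ … ⊗ Xₙ)` of functors of `(X₁, …, Xₙ)`. -/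
def MultiNat (V : D) (G : C ⥤ D) (n : ℕ) :
    Submodule k (∀ L : Tuple C n, src F V L ⟶ G.obj (tens L)) where
  carrier := {f | ∀ (L M : Tuple C n) (φ : Tuple.Hom L M),
    srcMap F (𝟙 V) φ ≫ f M = f L ≫ G.map (tensMap φ)}
  add_mem' {f g} hf hg := fun L M φ => by
    simp [Preadditive.comp_add, Preadditive.add_comp, hf L M φ, hg L M φ]
  zero_mem' := fun L M φ => by simp
  smul_mem' c f hf := fun L M φ => by
    simp [hf L M φ]

variable {k F}

theorem MultiNat.naturality {V : D} {G : C ⥤ D} {n : ℕ} (f : MultiNat k F V G n)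
    {L M : Tuple C n} (φ : Tuple.Hom L M) :
    srcMap F (𝟙 V) φ ≫ f.1 M = f.1 L ≫ G.map (tensMap φ) :=
  f.2 L M φ

/-- The inner coface `f ↦ f_{X₁, …, Xᵢ ⊗ Xᵢ₊₁, …, Xₙ₊₁} ∘ (id ⊗ F⁽²⁾_{Xᵢ, Xᵢ₊₁} ⊗ id)`, where
`i = j + 1`. -/
def innerFace [F.Monoidal] {V : D} {G : C ⥤ D} {n : ℕ} (j : Fin n) :
    MultiNat k F V G n →ₗ[k] MultiNat k F V G (n + 1) where
  toFun f := ⟨fun L => srcMerge F j V L ≫ f.1 (merge j L) ≫ G.map (tensMerge j L),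
    fun L M φ => by
      have h := MultiNat.naturality f (mergeHom j φ)
      rw [← Category.assoc, srcMerge_naturality, Category.assoc,
        reassoc_of% h, ← G.map_comp, tensMerge_naturality, G.map_comp]
      simp only [Category.assoc]⟩
  map_add' f g := by
    ext L
    simp [Preadditive.comp_add, Preadditive.add_comp]
  map_smul' c f := by
    ext L
    simp

/-- The structure maps entering the two outer cofaces on the natural transformations
`V ⊗ F(X₁) ⊗ … ⊗ F(Xₙ) ⟶ G(X₁ ⊗ … ⊗ Xₙ)`. -/
structure OuterData (F : C ⥤ D) (V : D) (G : C ⥤ D) where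
  swap : ∀ X : C, V ⊗ F.obj X ⟶ F.obj X ⊗ V
  left : ∀ X Y : C, F.obj X ⊗ G.obj Y ⟶ G.obj (X ⊗ Y)
  right : ∀ X Y : C, G.obj X ⊗ F.obj Y ⟶ G.obj (X ⊗ Y)
  swap_naturality : ∀ {X X' : C} (f : X ⟶ X'),
    V ◁ F.map f ≫ swap X' = swap X ≫ F.map f ▷ V
  left_naturality : ∀ {X X' Y Y' : C} (f : X ⟶ X') (g : Y ⟶ Y'),
    (F.map f ⊗ₘ G.map g) ≫ left X' Y' = left X Y ≫ G.map (f ⊗ₘ g)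
  right_naturality : ∀ {X X' Y Y' : C} (f : X ⟶ X') (g : Y ⟶ Y'),
    (G.map f ⊗ₘ F.map g) ≫ right X' Y' = right X Y ≫ G.map (f ⊗ₘ g)

variable [MonoidalPreadditive D] [MonoidalLinear k D]

/-- The coface `f ↦ left ∘ (id_{F(X₁)} ⊗ f_{X₂, …, Xₙ₊₁}) ∘ (swap_{X₁} ⊗ id)`. -/
def firstFace {V : D} {G : C ⥤ D} (S : OuterData F V G) (n : ℕ) :
    MultiNat k F V G n →ₗ[k] MultiNat k F V G (n + 1) where
  toFun f := ⟨fun L =>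
      (srcMap F (S.swap L.1) (Tuple.Hom.id L.2) ≫ srcPull F (F.obj L.1) V L.2 ≫
        F.obj L.1 ◁ f.1 L.2 ≫ S.left L.1 (tens L.2) :
          src F (V ⊗ F.obj L.1) L.2 ⟶ G.obj (L.1 ⊗ tens L.2)),
    fun L M φ => by
      have h := MultiNat.naturality f φ.2
      have h₁ : srcMap F (𝟙 V) φ ≫ srcMap F (S.swap M.1) (Tuple.Hom.id M.2) =
          srcMap F (S.swap L.1) (Tuple.Hom.id L.2) ≫ srcMap F (F.map φ.1 ⊗ₘ 𝟙 V) φ.2 := by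
        change srcMap F (𝟙 V ⊗ₘ F.map φ.1) φ.2 ≫ srcMap F (S.swap M.1) (Tuple.Hom.id M.2) = _
        rw [srcMap_comp, srcMap_comp, Tuple.Hom.id_comp, Tuple.Hom.comp_id, id_tensorHom,
          tensorHom_id, S.swap_naturality]
      have h₂ : (F.map φ.1 ⊗ₘ srcMap F (𝟙 V) φ.2) ≫ F.obj M.1 ◁ f.1 M.2 =
          F.obj L.1 ◁ f.1 L.2 ≫ (F.map φ.1 ⊗ₘ G.map (tensMap φ.2)) := by
        rw [← id_tensorHom, ← id_tensorHom, tensorHom_comp_tensorHom,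
          tensorHom_comp_tensorHom, h, Category.comp_id, Category.id_comp]
      have h₃ := S.left_naturality φ.1 (tensMap φ.2)
      have h₄ := srcPull_naturality F (F.map φ.1) (𝟙 V) φ.2
      rw [← Category.assoc, h₁]
      simp only [Category.assoc]
      rw [reassoc_of% h₄, reassoc_of% h₂, h₃]
      rfl⟩
  map_add' f g := by
    ext L
    simp [Preadditive.comp_add, Preadditive.add_comp]
  map_smul' c f := by
    ext L
    simp

/-- The coface `f ↦ right ∘ (f_{X₁, …, Xₙ} ⊗ id_{F(Xₙ₊₁)})`. -/
def lastFace {V : D} {G : C ⥤ D} (S : OuterData F V G) (n : ℕ) :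
    MultiNat k F V G n →ₗ[k] MultiNat k F V G (n + 1) where
  toFun f := ⟨fun L => srcSnoc F V L ≫ f.1 (Tuple.init L) ▷ F.obj (Tuple.last L) ≫
      S.right (tens (Tuple.init L)) (Tuple.last L) ≫ G.map (tensSnoc L),
    fun L M φ => by
      have h := MultiNat.naturality f φ.init
      have h₂ : (srcMap F (𝟙 V) φ.init ⊗ₘ F.map φ.last) ≫
            f.1 (Tuple.init M) ▷ F.obj (Tuple.last M) =
          f.1 (Tuple.init L) ▷ F.obj (Tuple.last L) ≫
            (G.map (tensMap φ.init) ⊗ₘ F.map φ.last) := by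
        rw [← tensorHom_id, ← tensorHom_id, tensorHom_comp_tensorHom,
          tensorHom_comp_tensorHom, h, Category.comp_id, Category.id_comp]
      have h₃ := S.right_naturality (tensMap φ.init) φ.last
      have h₄ := srcSnoc_naturality F (𝟙 V) φ
      rw [reassoc_of% h₄, reassoc_of% h₂, reassoc_of% h₃, ← G.map_comp, tensSnoc_naturality,
        G.map_comp]
      simp only [Category.assoc]⟩
  map_add' f g := by
    ext L
    simp [Preadditive.comp_add, Preadditive.add_comp]
  map_smul' c f := by
    ext L
    simp

/-- The differential `δⁿ = ∑ᵢ (-1)ⁱ ∂ᵢⁿ`, `0 ≤ i ≤ n + 1`, where `∂₀ⁿ` is the first face, `∂ᵢⁿ` for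
`1 ≤ i ≤ n` is the inner face with index `j = i - 1`, and `∂ₙ₊₁ⁿ` is the last face. -/
def differential [F.Monoidal] {V : D} {G : C ⥤ D} (S : OuterData F V G) (n : ℕ) :
    MultiNat k F V G n →ₗ[k] MultiNat k F V G (n + 1) :=
  firstFace S n + ∑ j : Fin n, (-1 : k) ^ ((j : ℕ) + 1) • innerFace j +
    (-1 : k) ^ (n + 1) • lastFace S n

end Cochains

/-! ### Davydov–Yetter cohomology -/

section Cohomology

/-- The coboundaries of degree `n` in a sequence of linear maps `dⁿ : Mⁿ → Mⁿ⁺¹`. -/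
def coboundaries {k : Type*} [Field k] {M : ℕ → Type*} [∀ n, AddCommGroup (M n)]
    [∀ n, Module k (M n)] (d : ∀ n, M n →ₗ[k] M (n + 1)) : (n : ℕ) → Submodule k (M n)
  | 0 => ⊥
  | n + 1 => LinearMap.range (d n)

/-- The cohomology `Zⁿ / Bⁿ` of a cochain complex of vector spaces. -/
abbrev Cohomology {k : Type*} [Field k] {M : ℕ → Type*} [∀ n, AddCommGroup (M n)]
    [∀ n, Module k (M n)] (d : ∀ n, M n →ₗ[k] M (n + 1)) (n : ℕ) :=
  LinearMap.ker (d n) ⧸ (coboundaries d n).submoduleOf (LinearMap.ker (d n))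

variable (k : Type w) [Field k]
  {C : Type u₁} [Category.{v₁} C] [MonoidalCategory C]
  {D : Type u₂} [Category.{v₂} D] [MonoidalCategory D] [Preadditive D] [Linear k D]
  [MonoidalPreadditive D] [MonoidalLinear k D]
  (F : C ⥤ D) [F.Monoidal]

/-- The structure maps for the natural transformations `F(X₁) ⊗ … ⊗ F(Xₙ) ⟶ F(X₁ ⊗ … ⊗ Xₙ)`. -/
def trivialOuterData : OuterData F (𝟙_ D) F where
  swap X := (λ_ (F.obj X)).hom ≫ (ρ_ (F.obj X)).inv
  left X Y := μ F X Y
  right X Y := μ F X Y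
  swap_naturality f := by
    rw [MonoidalCategory.leftUnitor_naturality_assoc,
      MonoidalCategory.rightUnitor_inv_naturality, Category.assoc]
  left_naturality f g := μ_natural F f g
  right_naturality f g := μ_natural F f g

variable {F}

/-- The structure maps for the natural transformations
`V ⊗ F(X₁) ⊗ … ⊗ F(Xₙ) ⟶ F(X₁ ⊗ … ⊗ Xₙ) ⊗ W`, for coefficients `V, W` in `𝒵(F)`. -/
def coeffOuterData (V W : Centralizer F) : OuterData F V.obj (F ⋙ tensorRight W.obj) where
  swap X := (V.braid X).hom
  left X Y := (α_ (F.obj X) (F.obj Y) W.obj).inv ≫ μ F X Y ▷ W.obj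
  right X Y := (α_ (F.obj X) W.obj (F.obj Y)).hom ≫ F.obj X ◁ (W.braid Y).hom ≫
    (α_ (F.obj X) (F.obj Y) W.obj).inv ≫ μ F X Y ▷ W.obj
  swap_naturality f := V.naturality f
  left_naturality {X X' Y Y'} f g := by
    change (F.map f ⊗ₘ (F.map g ▷ W.obj)) ≫
        (α_ (F.obj X') (F.obj Y') W.obj).inv ≫ μ F X' Y' ▷ W.obj =
      ((α_ (F.obj X) (F.obj Y) W.obj).inv ≫ μ F X Y ▷ W.obj) ≫ F.map (f ⊗ₘ g) ▷ W.obj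
    rw [← tensorHom_id, associator_inv_naturality_assoc, tensorHom_id, Category.assoc,
      ← comp_whiskerRight, ← comp_whiskerRight, μ_natural]
  right_naturality {X X' Y Y'} f g := by
    change ((F.map f ▷ W.obj) ⊗ₘ F.map g) ≫
        (α_ (F.obj X') W.obj (F.obj Y')).hom ≫ F.obj X' ◁ (W.braid Y').hom ≫
          (α_ (F.obj X') (F.obj Y') W.obj).inv ≫ μ F X' Y' ▷ W.obj =
      ((α_ (F.obj X) W.obj (F.obj Y)).hom ≫ F.obj X ◁ (W.braid Y).hom ≫
          (α_ (F.obj X) (F.obj Y) W.obj).inv ≫ μ F X Y ▷ W.obj) ≫ F.map (f ⊗ₘ g) ▷ W.obj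
    have h : (F.map f ⊗ₘ (W.obj ◁ F.map g)) ≫ F.obj X' ◁ (W.braid Y').hom =
        F.obj X ◁ (W.braid Y).hom ≫ (F.map f ⊗ₘ (F.map g ▷ W.obj)) := by
      rw [← id_tensorHom, ← id_tensorHom (F.obj X'), ← id_tensorHom (F.obj X),
        tensorHom_comp_tensorHom, tensorHom_comp_tensorHom, id_tensorHom, W.naturality,
        Category.comp_id, Category.id_comp]
    rw [← tensorHom_id, associator_naturality_assoc, id_tensorHom, reassoc_of% h,
      ← tensorHom_id, associator_inv_naturality_assoc, tensorHom_id]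
    simp only [Category.assoc]
    rw [← comp_whiskerRight, ← comp_whiskerRight, μ_natural]

variable (F)

/-- The Davydov–Yetter cohomology `Hⁿ_DY(F)` of a monoidal functor `F`, whose cochains of degree
`n` are the natural transformations `F(X₁) ⊗ … ⊗ F(Xₙ) ⟶ F(X₁ ⊗ … ⊗ Xₙ)`. -/
abbrev DYCohomology (n : ℕ) :=
  Cohomology (M := fun n => MultiNat k F (𝟙_ D) F n) (differential (trivialOuterData F)) n

/-- The Davydov–Yetter cohomology `Hⁿ_DY(F; V, W)` with coefficients `V, W` in `𝒵(F)`, whose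
cochains of degree `n` are the natural transformations
`V ⊗ F(X₁) ⊗ … ⊗ F(Xₙ) ⟶ F(X₁ ⊗ … ⊗ Xₙ) ⊗ W`. -/
abbrev DYCohomologyCoeff (V W : Centralizer F) (n : ℕ) :=
  Cohomology (M := fun n => MultiNat k F V.obj (F ⋙ tensorRight W.obj) n)
    (differential (coeffOuterData V W)) n

end Cohomology

end DavydovYetter
end

/-!
Everything rests on universal arrows `u : F(B) ⟶ W`, such as the counits `F(R(W)) ⟶ W`. Because
monoidal functors preserve duals and `C` is rigid, the morphisms
`F(X ⊗ B) ≅ F(X) ⊗ F(B) ⟶ F(X) ⊗ W` and `F(B ⊗ X) ≅ F(B) ⊗ F(X) ⟶ W ⊗ F(X)` obtained from `u` are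
universal as well (`IsUniversalArrow.whiskerLeft`, `IsUniversalArrow.whiskerRight`). This is the
projection formula `R(F(X) ⊗ W) ≅ X ⊗ R(W)` and its mirror image, stated without `R`.

*Lifting the adjunction.* If `W` carries a half-braiding, then `B ⊗ X` and `X ⊗ B` are sources of
universal arrows to the isomorphic objects `W ⊗ F(X)` and `F(X) ⊗ W`, which gives an isomorphism
`B ⊗ X ≅ X ⊗ B`. Naturality and the hexagon can be checked after composition with the universal
arrow, where they are those of `W`. So `R(W)` becomes an object of the Drinfeld center, and the
bijections of `F ⊣ R` restrict to morphisms compatible with half-braidings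
(`Centralizer.liftHomEquiv`). By uniqueness of adjoints, the counit of any right adjoint of the lift
of `F` is a universal arrow on underlying objects (`Centralizer.isUniversalArrow_counit_app`).

*Comparing cohomology.* Let `u : F̃(B) ⟶ W` be a morphism of `𝒵(F)` that is a universal arrow on
underlying objects. Since `F` is monoidal, the universal arrow `F(Y ⊗ B) ⟶ F(Y) ⊗ W` with
`Y = X₁ ⊗ … ⊗ Xₙ` gives a bijection between morphisms `V ⊗ X₁ ⊗ … ⊗ Xₙ ⟶ Y ⊗ B` and morphisms
`F(V) ⊗ F(X₁) ⊗ … ⊗ F(Xₙ) ⟶ F(Y) ⊗ W` (`transpose_bijective`). It identifies natural families with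
natural families and commutes with every coface, the last one because `u` is compatible with
half-braidings. Hence it is an isomorphism of complexes (`nonempty_DYCohomologyCoeff_lift_equiv`),
to be applied to the counit at `W`. The cohomology without coefficients is the case of unit
coefficients (`nonempty_DYCohomology_equiv`).
-/

noncomputable section

namespace DavydovYetter

open Functor.LaxMonoidal Functor.OplaxMonoidal

/-! ### Universal arrows -/

section UniversalArrows

variable {C : Type u₁} [Category.{v₁} C] {D : Type u₂} [Category.{v₂} D]

/-- A morphism `u : F(B) ⟶ W` is universal if every `F(A) ⟶ W` factors as `F(g) ≫ u` for a unique
`g : A ⟶ B`. If `F` has a right adjoint, this says that `B`, together with `u`, is its value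
at `W`. -/
def IsUniversalArrow (F : C ⥤ D) {B : C} {W : D} (u : F.obj B ⟶ W) : Prop :=
  ∀ A : C, Function.Bijective fun g : A ⟶ B => F.map g ≫ u

variable {F : C ⥤ D}

theorem map_homEquiv_counit {R : D ⥤ C} (adj : F ⊣ R) {A : C} {W : D} (f : F.obj A ⟶ W) :
    F.map (adj.homEquiv A W f) ≫ adj.counit.app W = f :=
  (adj.homEquiv_counit A W _).symm.trans ((adj.homEquiv A W).symm_apply_apply f)

namespace IsUniversalArrow

theorem counit_app {R : D ⥤ C} (adj : F ⊣ R) (W : D) : IsUniversalArrow F (adj.counit.app W) :=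
  fun A =>
    have h : (fun g : A ⟶ R.obj W => F.map g ≫ adj.counit.app W) = (adj.homEquiv A W).symm :=
      funext fun g => (adj.homEquiv_counit A W g).symm
    h.symm ▸ (adj.homEquiv A W).symm.bijective

theorem map_comp {B B' : C} {W : D} {u : F.obj B ⟶ W} (h : IsUniversalArrow F u) (i : B' ≅ B) :
    IsUniversalArrow F (F.map i.hom ≫ u) := fun A => by
  convert (h A).comp ((Iso.refl A).homCongr i).bijective using 2 with g
  simp

variable {B : C} {W : D} {u : F.obj B ⟶ W}

theorem hom_ext (h : IsUniversalArrow F u) {A : C} {g g' : A ⟶ B}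
    (e : F.map g ≫ u = F.map g' ≫ u) : g = g' :=
  (h A).1 e

/-- The morphism `A ⟶ B` corresponding to `f : F(A) ⟶ W` under a universal arrow `F(B) ⟶ W`. -/
def desc (h : IsUniversalArrow F u) {A : C} (f : F.obj A ⟶ W) : A ⟶ B :=
  ((h A).2 f).choose

theorem map_desc (h : IsUniversalArrow F u) {A : C} (f : F.obj A ⟶ W) :
    F.map (h.desc f) ≫ u = f :=
  ((h A).2 f).choose_spec

/-- Universal arrows to isomorphic objects have isomorphic sources. -/
def iso (h : IsUniversalArrow F u) {B' : C} {W' : D} {u' : F.obj B' ⟶ W'}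
    (h' : IsUniversalArrow F u') (i : W ≅ W') : B ≅ B' where
  hom := h'.desc (u ≫ i.hom)
  inv := h.desc (u' ≫ i.inv)
  hom_inv_id := h.hom_ext (by simp [map_desc, reassoc_of% h'.map_desc])
  inv_hom_id := h'.hom_ext (by simp [map_desc, reassoc_of% h.map_desc])

theorem map_iso_hom (h : IsUniversalArrow F u) {B' : C} {W' : D} {u' : F.obj B' ⟶ W'}
    (h' : IsUniversalArrow F u') (i : W ≅ W') :
    F.map (h.iso h' i).hom ≫ u' = u ≫ i.hom :=
  h'.map_desc _

end IsUniversalArrow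

variable [MonoidalCategory C] [MonoidalCategory D] (F) [F.Monoidal]

/-- A monoidal functor preserves duals. -/
@[reducible]
def mapExactPairing (X Y : C) [ExactPairing X Y] : ExactPairing (F.obj X) (F.obj Y) where
  coevaluation' := ε F ≫ F.map (η_ X Y) ≫ δ F X Y
  evaluation' := μ F Y X ≫ F.map (ε_ X Y) ≫ η F
  coevaluation_evaluation' := by
    have h := congrArg F.map (ExactPairing.coevaluation_evaluation X Y)
    simp only [F.map_comp, Functor.Monoidal.map_associator_inv, Functor.Monoidal.map_whiskerLeft,
      Functor.Monoidal.map_whiskerRight, Functor.Monoidal.map_rightUnitor,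
      Functor.Monoidal.map_leftUnitor_inv, Category.assoc, Functor.Monoidal.μ_δ_assoc] at h
    rw [cancel_epi, ← cancel_epi (F.obj Y ◁ ε F)] at h
    simp only [← Category.assoc, cancel_mono] at h
    rw [← cancel_mono (η F ▷ F.obj Y)] at h
    simpa using h
  evaluation_coevaluation' := by
    have h := congrArg F.map (ExactPairing.evaluation_coevaluation X Y)
    simp only [F.map_comp, Functor.Monoidal.map_associator, Functor.Monoidal.map_whiskerLeft,
      Functor.Monoidal.map_whiskerRight, Functor.Monoidal.map_leftUnitor,
      Functor.Monoidal.map_rightUnitor_inv, Category.assoc, Functor.Monoidal.μ_δ_assoc] at h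
    rw [cancel_epi, ← cancel_epi (ε F ▷ F.obj X)] at h
    simp only [← Category.assoc, cancel_mono] at h
    rw [← cancel_mono (F.obj X ◁ η F)] at h
    simpa using h

/-- A monoidal functor carries the duality bijection `Hom(Y ⊗ A, Z) ≃ Hom(A, X ⊗ Z)` to that of the
image duality. -/
theorem map_tensorLeftHomEquiv {A X Y Z : C} [ExactPairing X Y] (h : Y ⊗ A ⟶ Z) :
    letI := mapExactPairing F X Y
    F.map (tensorLeftHomEquiv A X Y Z h) ≫ δ F X Z =
      tensorLeftHomEquiv (F.obj A) (F.obj X) (F.obj Y) (F.obj Z) (μ F Y A ≫ F.map h) := by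
  -- The coevaluation of `mapExactPairing` is unfolded.
  change _ = (λ_ _).inv ≫ (ε F ≫ F.map (η_ X Y) ≫ δ F X Y) ▷ _ ≫ (α_ _ _ _).hom ≫ _ ◁ _
  simp only [tensorLeftHomEquiv, Equiv.coe_fn_mk, F.map_comp, Category.assoc, comp_whiskerRight,
    MonoidalCategory.whiskerLeft_comp, Functor.Monoidal.μ_δ, Functor.Monoidal.μ_δ_assoc,
    Category.comp_id, Functor.Monoidal.map_associator, Functor.Monoidal.map_whiskerLeft,
      Functor.Monoidal.map_whiskerRight, Functor.Monoidal.map_leftUnitor_inv]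

/-- The mirror image of `map_tensorLeftHomEquiv`, for `Hom(A ⊗ Y, Z) ≃ Hom(A, Z ⊗ X)`. -/
theorem map_tensorRightHomEquiv {A X Y Z : C} [ExactPairing Y X] (h : A ⊗ Y ⟶ Z) :
    letI := mapExactPairing F Y X
    F.map (tensorRightHomEquiv A Y X Z h) ≫ δ F Z X =
      tensorRightHomEquiv (F.obj A) (F.obj Y) (F.obj X) (F.obj Z) (μ F A Y ≫ F.map h) := by
  change _ = (ρ_ _).inv ≫ _ ◁ (ε F ≫ F.map (η_ Y X) ≫ δ F Y X) ≫ (α_ _ _ _).inv ≫ _ ▷ _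
  simp only [tensorRightHomEquiv, Equiv.coe_fn_mk, F.map_comp, Category.assoc, comp_whiskerRight,
    MonoidalCategory.whiskerLeft_comp, Functor.Monoidal.μ_δ, Functor.Monoidal.μ_δ_assoc,
    Category.comp_id, Functor.Monoidal.map_associator_inv, Functor.Monoidal.map_whiskerLeft,
      Functor.Monoidal.map_whiskerRight, Functor.Monoidal.map_rightUnitor_inv]

namespace IsUniversalArrow

variable {F} {B : C} {W : D} {u : F.obj B ⟶ W}

/-- Tensoring a universal arrow on the left with `F(X)` is universal, because by duality a morphism
`F(A) ⟶ F(X) ⊗ W` amounts to a morphism `F(Xᘁ ⊗ A) ⟶ W`. -/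
theorem whiskerLeft (h : IsUniversalArrow F u) (X : C) [HasRightDual X] :
    IsUniversalArrow F (δ F X B ≫ F.obj X ◁ u) := fun A => by
  let := mapExactPairing F X Xᘁ
  convert (((tensorLeftHomEquiv (F.obj A) (F.obj X) (F.obj Xᘁ) W).bijective.comp
    ((Functor.Monoidal.μIso F Xᘁ A).symm.homCongr (Iso.refl W)).bijective).comp (h (Xᘁ ⊗ A))).comp
    (tensorLeftHomEquiv A X Xᘁ B).symm.bijective using 2 with g
  obtain ⟨g, rfl⟩ := (tensorLeftHomEquiv A X Xᘁ B).surjective g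
  rw [← Category.assoc, map_tensorLeftHomEquiv, ← tensorLeftHomEquiv_naturality]
  simp

/-- The mirror image of `whiskerLeft`: a morphism `F(A) ⟶ W ⊗ F(X)` amounts to a morphism
`F(A ⊗ ᘁX) ⟶ W`. -/
theorem whiskerRight (h : IsUniversalArrow F u) (X : C) [HasLeftDual X] :
    IsUniversalArrow F (δ F B X ≫ u ▷ F.obj X) := fun A => by
  let := mapExactPairing F (ᘁX) X
  convert (((tensorRightHomEquiv (F.obj A) (F.obj (ᘁX)) (F.obj X) W).bijective.comp
    ((Functor.Monoidal.μIso F A (ᘁX)).symm.homCongr (Iso.refl W)).bijective).comp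
      (h (A ⊗ ᘁX))).comp (tensorRightHomEquiv A (ᘁX) X B).symm.bijective using 2 with g
  obtain ⟨g, rfl⟩ := (tensorRightHomEquiv A (ᘁX) X B).surjective g
  rw [← Category.assoc, map_tensorRightHomEquiv, ← tensorRightHomEquiv_naturality]
  simp

end IsUniversalArrow

end UniversalArrows

/-! ### The lifted adjunction -/

section LiftedAdjunction

variable {C : Type u₁} [Category.{v₁} C] [MonoidalCategory C]
  {D : Type u₂} [Category.{v₂} D] [MonoidalCategory D] {F : C ⥤ D} [F.Monoidal]

/-- If `g` becomes compatible with half-braidings after applying `F` and composing with a universal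
arrow, it is compatible with half-braidings. -/
theorem IsUniversalArrow.comm {B V X : C} [HasRightDual X] {W : D} {u : F.obj B ⟶ W}
    (hu : IsUniversalArrow F u) {b : V ⊗ X ⟶ X ⊗ V} {c : B ⊗ X ⟶ X ⊗ B}
    {d : W ⊗ F.obj X ⟶ F.obj X ⊗ W} {g : V ⟶ B} {f : F.obj V ⟶ W}
    (h₁ : u ▷ F.obj X ≫ d = (μ F B X ≫ F.map c ≫ δ F X B) ≫ F.obj X ◁ u)
    (h₂ : f ▷ F.obj X ≫ d = (μ F V X ≫ F.map b ≫ δ F X V) ≫ F.obj X ◁ f)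
    (hg : F.map g ≫ u = f) : g ▷ X ≫ c = b ≫ X ◁ g := by
  apply (hu.whiskerLeft X).hom_ext
  rw [← hg, comp_whiskerRight, Category.assoc, h₁, MonoidalCategory.whiskerLeft_comp] at h₂
  simp only [Category.assoc, μ_natural_left_assoc, cancel_epi, δ_natural_right_assoc] at h₂
  simpa only [F.map_comp, Category.assoc] using h₂

namespace IsUniversalArrow

variable [RigidCategory C] {W : Centralizer F} {B : C} {u : F.obj B ⟶ W.obj}

/-- The half-braiding `B ⊗ X ≅ X ⊗ B` obtained from that of `W` along a universal arrow
`F(B) ⟶ W`. -/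
def braid (h : IsUniversalArrow F u) (X : C) : B ⊗ X ≅ X ⊗ B :=
  (h.whiskerRight X).iso (h.whiskerLeft X) (W.braid X)

/-- The half-braiding on `B` is characterized by its compatibility with that of `W` along `u`. -/
theorem map_braid_hom (h : IsUniversalArrow F u) (X : C) :
    F.map (h.braid X).hom ≫ δ F X B ≫ F.obj X ◁ u =
      δ F B X ≫ u ▷ F.obj X ≫ (W.braid X).hom :=
  ((h.whiskerRight X).map_iso_hom (h.whiskerLeft X) (W.braid X)).trans (Category.assoc _ _ _)

theorem braid_naturality (h : IsUniversalArrow F u) {X Y : C} (f : X ⟶ Y) :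
    B ◁ f ≫ (h.braid Y).hom = (h.braid X).hom ≫ f ▷ B := by
  apply (h.whiskerLeft Y).hom_ext
  rw [F.map_comp, Category.assoc, map_braid_hom, F.map_comp, Category.assoc,
    ← δ_natural_left_assoc, ← whisker_exchange, reassoc_of% h.map_braid_hom X,
    ← δ_natural_right_assoc, whisker_exchange_assoc, W.naturality]

theorem braid_hexagon (h : IsUniversalArrow F u) (X Y : C) :
    (h.braid (X ⊗ Y)).hom = (α_ B X Y).inv ≫ (h.braid X).hom ▷ Y ≫
      (α_ X B Y).hom ≫ X ◁ (h.braid Y).hom ≫ (α_ X Y B).inv := by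
  apply (h.whiskerLeft (X ⊗ Y)).hom_ext
  -- `lift_hexagon` holds for arbitrary morphisms in place of half-braidings, so it moves the right
  -- side of the hexagon from `C` to `D`.
  have e := Centralizer.lift_hexagon F (h.braid X).hom (h.braid Y).hom
  have e₁ (X : C) : u ▷ F.obj X ≫ (W.braid X).hom =
      (μ F B X ≫ F.map (h.braid X).hom ≫ δ F X B) ≫ F.obj X ◁ u := by
    rw [Category.assoc, Category.assoc, map_braid_hom, Functor.Monoidal.μ_δ_assoc]
  rw [map_braid_hom, ← cancel_epi (F.obj B ◁ μ F X Y ≫ μ F B (X ⊗ Y))]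
  simp only [Category.assoc] at e ⊢
  rw [reassoc_of% e, Functor.Monoidal.μ_δ_assoc, whisker_exchange_assoc, W.hexagon,
    ← whisker_exchange, tensor_whiskerLeft_assoc]
  have e₂ := congrArg (F.obj X ◁ ·) (e₁ Y)
  have e₃ := congrArg (· ▷ F.obj Y) (e₁ X)
  simp only [MonoidalCategory.whiskerLeft_comp, comp_whiskerRight, Category.assoc,
    Iso.inv_hom_id_assoc] at e₂ e₃ ⊢
  rw [← reassoc_of% e₂, ← associator_naturality_middle_assoc, ← reassoc_of% e₃,
    whiskerRight_tensor_assoc, Iso.hom_inv_id_assoc]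

/-- The lift of the source of a universal arrow `F(B) ⟶ W` to the Drinfeld center of `C`. -/
def center (h : IsUniversalArrow F u) : Centralizer (𝟭 C) where
  obj := B
  braid X := h.braid X
  naturality f := h.braid_naturality f
  hexagon X Y := by
    simpa using h.braid_hexagon X Y

/-- A universal arrow `F(B) ⟶ W` as a morphism of `𝒵(F)`. -/
def centerHom (h : IsUniversalArrow F u) : (Centralizer.lift F).obj h.center ⟶ W :=
  Centralizer.Hom.mk u fun X => by
    have e : (μ F B X ≫ F.map (h.braid X).hom ≫ δ F X B) ≫ F.obj X ◁ u =
        u ▷ F.obj X ≫ (W.braid X).hom := by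
      rw [Category.assoc, Category.assoc, map_braid_hom, Functor.Monoidal.μ_δ_assoc]
    exact e.symm

end IsUniversalArrow

namespace Centralizer

variable [RigidCategory C] {R : D ⥤ C} (adj : F ⊣ R)

/-- The value of the lifted right adjoint at `W`: the object `R(W)` with the half-braiding
corresponding to that of `W`. -/
def rightLiftObj (W : Centralizer F) : Centralizer (𝟭 C) :=
  (IsUniversalArrow.counit_app adj W.obj).center

/-- The bijection `Hom(F̃(V), W) ≃ Hom(V, R̃(W))`, which is that of `F ⊣ R` on underlying
morphisms. -/
def liftHomEquiv (V : Centralizer (𝟭 C)) (W : Centralizer F) :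
    ((lift F).obj V ⟶ W) ≃ (V ⟶ rightLiftObj adj W) where
  toFun f := Hom.mk (adj.homEquiv V.obj W.obj f.hom) fun X =>
    (IsUniversalArrow.counit_app adj W.obj).comm
      ((IsUniversalArrow.counit_app adj W.obj).centerHom.comm X) (f.comm X)
      (map_homEquiv_counit adj f.hom)
  invFun g := (lift F).map g ≫ (IsUniversalArrow.counit_app adj W.obj).centerHom
  left_inv f := Hom.ext (map_homEquiv_counit adj f.hom)
  right_inv g := Hom.ext <|
    (congrArg (adj.homEquiv V.obj W.obj) (adj.homEquiv_counit V.obj W.obj g.hom).symm).trans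
      ((adj.homEquiv V.obj W.obj).apply_symm_apply g.hom)

theorem liftHomEquiv_naturality (V' V : Centralizer (𝟭 C)) (W : Centralizer F) (f : V' ⟶ V)
    (g : (lift F).obj V ⟶ W) :
    liftHomEquiv adj V' W ((lift F).map f ≫ g) = f ≫ liftHomEquiv adj V W g :=
  Hom.ext (adj.homEquiv_naturality_left f.hom g.hom)

/-- The right adjoint `R̃ : 𝒵(F) ⥤ 𝒵(C)` of `F̃`. Its value on morphisms, given by transposition, is
that of `R` (`rightLift_map_hom`). -/
def rightLift : Centralizer F ⥤ Centralizer (𝟭 C) :=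
  Adjunction.rightAdjointOfEquiv (liftHomEquiv adj) (liftHomEquiv_naturality adj)

/-- The adjunction `F̃ ⊣ R̃`. -/
def liftAdjunction : lift F ⊣ rightLift adj :=
  Adjunction.adjunctionOfEquivRight (liftHomEquiv adj) (liftHomEquiv_naturality adj)

theorem rightLift_map_hom {V W : Centralizer F} (f : V ⟶ W) :
    ((rightLift adj).map f).hom = R.map f.hom := by
  change adj.homEquiv _ _ ((F.map (𝟙 _) ≫ adj.counit.app V.obj) ≫ f.hom) = _
  simp [Adjunction.homEquiv_unit]

theorem isLiftedAdjunction_liftAdjunction :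
    IsLiftedAdjunction adj (liftAdjunction adj) := by
  refine ⟨NatIso.ofComponents (fun W => Iso.refl (R.obj W.obj)) fun f => ?_, fun V => ?_,
    fun W => ?_⟩
  · exact (Category.comp_id _).trans ((rightLift_map_hom adj f).trans (Category.id_comp _).symm)
  · change adj.homEquiv _ _ (𝟙 _) ≫ 𝟙 _ = _
    simp [Adjunction.homEquiv_unit]
  · rfl

/-- Whichever right adjoint of `F̃` is chosen, its counit is a universal arrow on underlying
objects, since right adjoints are unique up to isomorphism. -/
theorem isUniversalArrow_counit_app {R' : Centralizer F ⥤ Centralizer (𝟭 C)}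
    (adj' : lift F ⊣ R') (adj : F ⊣ R) (W : Centralizer F) :
    IsUniversalArrow F (adj'.counit.app W).hom := by
  let i := (adj'.rightAdjointUniq (liftAdjunction adj)).app W
  have h : (adj'.counit.app W).hom = F.map i.hom.hom ≫ adj.counit.app W.obj := by
    have h := congrArg Hom.hom (adj'.rightAdjointUniq_hom_app_counit (liftAdjunction adj) W)
    have h' : ((liftAdjunction adj).counit.app W).hom = adj.counit.app W.obj := by
      change F.map (𝟙 _) ≫ adj.counit.app W.obj = _
      simp
    rw [comp_hom, h'] at h
    exact h.symm
  rw [h]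
  exact (IsUniversalArrow.counit_app adj W.obj).map_comp ((forget (𝟭 C)).mapIso i)

end Centralizer

end LiftedAdjunction

/-! ### The monoidal structure on iterated tensor products -/

section Tuples

variable {C : Type u₁} [Category.{v₁} C]

theorem Tuple.Hom.init_id : ∀ {n : ℕ} (L : Tuple C (n + 1)),
    (Tuple.Hom.id L).init = Tuple.Hom.id (Tuple.init L)
  | 0, _ => rfl
  | _ + 1, L => Prod.ext rfl (Tuple.Hom.init_id L.2)

theorem Tuple.Hom.last_id : ∀ {n : ℕ} (L : Tuple C (n + 1)),
    (Tuple.Hom.id L).last = 𝟙 (Tuple.last L)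
  | 0, _ => rfl
  | _ + 1, L => Tuple.Hom.last_id L.2

theorem mergeHom_id [MonoidalCategory C] : ∀ {n : ℕ} (j : Fin n) (L : Tuple C (n + 1)),
    mergeHom j (Tuple.Hom.id L) = Tuple.Hom.id (merge j L)
  | _ + 1, ⟨0, _⟩, L => Prod.ext (id_tensorHom_id L.1 L.2.1) rfl
  | _ + 1, ⟨j + 1, h⟩, L => Prod.ext rfl (mergeHom_id ⟨j, Nat.lt_of_succ_lt_succ h⟩ L.2)

end Tuples

section Source

variable {C : Type u₁} [Category.{v₁} C] {D : Type u₂} [Category.{v₂} D] [MonoidalCategory D]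
  (F : C ⥤ D)

theorem srcMap_id : ∀ {n : ℕ} (V : D) (L : Tuple C n),
    srcMap F (𝟙 V) (Tuple.Hom.id L) = 𝟙 (src F V L)
  | 0, _, _ => rfl
  | _ + 1, V, L => by
    change srcMap F (𝟙 V ⊗ₘ F.map (𝟙 L.1)) (Tuple.Hom.id L.2) = _
    rw [F.map_id, id_tensorHom_id]
    exact srcMap_id _ L.2

instance isIso_srcMap {n : ℕ} {V W : D} (a : V ⟶ W) [IsIso a] (L : Tuple C n) :
    IsIso (srcMap F a (Tuple.Hom.id L)) :=
  ⟨srcMap F (inv a) (Tuple.Hom.id L), by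
    rw [srcMap_comp, srcMap_comp, Tuple.Hom.id_comp, IsIso.hom_inv_id, IsIso.inv_hom_id,
      srcMap_id, srcMap_id]
    exact ⟨rfl, rfl⟩⟩

variable [MonoidalCategory C] [F.Monoidal]

/-- The monoidal structure of `F` as a morphism
`F(V) ⊗ F(X₁) ⊗ … ⊗ F(Xₙ) ⟶ F(V ⊗ X₁ ⊗ … ⊗ Xₙ)`. -/
def srcμ : {n : ℕ} → (V : C) → (L : Tuple C n) →
    (src F (F.obj V) L ⟶ F.obj (src (𝟭 C) V L))
  | 0, V, _ => 𝟙 (F.obj V)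
  | _ + 1, V, L => srcMap F (μ F V L.1) (Tuple.Hom.id L.2) ≫ srcμ (V ⊗ L.1) L.2

instance isIso_srcμ : ∀ {n : ℕ} (V : C) (L : Tuple C n), IsIso (srcμ F V L)
  | 0, V, _ => inferInstanceAs (IsIso (𝟙 (F.obj V)))
  | _ + 1, V, L => by
    have := isIso_srcμ (V ⊗ L.1) L.2
    exact IsIso.comp_isIso (f := srcMap F (μ F V L.1) (Tuple.Hom.id L.2))

theorem srcμ_succ {n : ℕ} (V : C) (L : Tuple C (n + 1)) :
    srcμ F V L = srcMap F (μ F V L.1) (Tuple.Hom.id L.2) ≫ srcμ F (V ⊗ L.1) L.2 := rfl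

theorem srcμ_naturality : ∀ {n : ℕ} {V W : C} (a : V ⟶ W) {L M : Tuple C n} (φ : Tuple.Hom L M),
    srcMap F (F.map a) φ ≫ srcμ F W M = srcμ F V L ≫ F.map (srcMap (𝟭 C) a φ)
  | 0, V, W, a, _, _, _ => (Category.comp_id (F.map a)).trans (Category.id_comp (F.map a)).symm
  | _ + 1, V, W, a, L, M, φ => by
    change srcMap F (F.map a ⊗ₘ F.map φ.1) φ.2 ≫ _ = _ ≫ F.map (srcMap (𝟭 C) (a ⊗ₘ φ.1) φ.2)
    have ih := srcμ_naturality (a ⊗ₘ φ.1) φ.2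
    rw [srcμ_succ, srcμ_succ, Category.assoc, ← ih, ← Category.assoc, ← Category.assoc,
      srcMap_comp, srcMap_comp, Tuple.Hom.id_comp, Tuple.Hom.comp_id, μ_natural]

theorem srcMerge_srcμ : ∀ {n : ℕ} (j : Fin n) (V : C) (L : Tuple C (n + 1)),
    srcMerge F j (F.obj V) L ≫ srcμ F V (merge j L) =
      srcμ F V L ≫ F.map (srcMerge (𝟭 C) j V L)
  | _ + 1, ⟨0, _⟩, V, L => by
    have h := srcμ_naturality F ((α_ V L.1 L.2.1).hom ≫ V ◁ 𝟙 (L.1 ⊗ L.2.1))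
      (Tuple.Hom.id L.2.2)
    change srcMap F ((α_ (F.obj V) (F.obj L.1) (F.obj L.2.1)).hom ≫ F.obj V ◁ μ F L.1 L.2.1)
          (Tuple.Hom.id L.2.2) ≫
        srcMap F (μ F V (L.1 ⊗ L.2.1)) (Tuple.Hom.id L.2.2) ≫ srcμ F (V ⊗ L.1 ⊗ L.2.1) L.2.2 =
      (srcMap F (μ F V L.1 ⊗ₘ F.map (𝟙 L.2.1)) (Tuple.Hom.id L.2.2) ≫
        srcMap F (μ F (V ⊗ L.1) L.2.1) (Tuple.Hom.id L.2.2) ≫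
          srcμ F ((V ⊗ L.1) ⊗ L.2.1) L.2.2) ≫
      F.map (srcMap (𝟭 C) ((α_ V L.1 L.2.1).hom ≫ V ◁ 𝟙 (L.1 ⊗ L.2.1)) (Tuple.Hom.id L.2.2))
    rw [Category.assoc, Category.assoc, ← h]
    simp only [← Category.assoc, srcMap_comp, Tuple.Hom.comp_id, F.map_id, tensorHom_id,
      MonoidalCategory.whiskerLeft_id, Category.comp_id]
    simp only [Category.assoc, Functor.LaxMonoidal.associativity]
  | _ + 1, ⟨j + 1, h⟩, V, L => by
    have ih := srcMerge_srcμ ⟨j, Nat.lt_of_succ_lt_succ h⟩ (V ⊗ L.1) L.2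
    have hn := srcMerge_naturality F ⟨j, Nat.lt_of_succ_lt_succ h⟩ (μ F V L.1)
      (Tuple.Hom.id L.2)
    rw [mergeHom_id] at hn
    change srcMerge F ⟨j, Nat.lt_of_succ_lt_succ h⟩ (F.obj V ⊗ F.obj L.1) L.2 ≫
        srcMap F (μ F V L.1) (Tuple.Hom.id (merge ⟨j, Nat.lt_of_succ_lt_succ h⟩ L.2)) ≫
          srcμ F (V ⊗ L.1) (merge ⟨j, Nat.lt_of_succ_lt_succ h⟩ L.2) =
      (srcMap F (μ F V L.1) (Tuple.Hom.id L.2) ≫ srcμ F (V ⊗ L.1) L.2) ≫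
        F.map (srcMerge (𝟭 C) ⟨j, Nat.lt_of_succ_lt_succ h⟩ (V ⊗ L.1) L.2)
    rw [← Category.assoc, ← hn, Category.assoc, ih, Category.assoc]

theorem srcPull_srcμ : ∀ {n : ℕ} (A V : C) (L : Tuple C n),
    srcPull F (F.obj A) (F.obj V) L ≫ F.obj A ◁ srcμ F V L ≫ μ F A (src (𝟭 C) V L) =
      srcMap F (μ F A V) (Tuple.Hom.id L) ≫ srcμ F (A ⊗ V) L ≫ F.map (srcPull (𝟭 C) A V L)
  | 0, A, V, _ => by
    change 𝟙 _ ≫ F.obj A ◁ 𝟙 (F.obj V) ≫ μ F A V = μ F A V ≫ 𝟙 _ ≫ F.map (𝟙 (A ⊗ V))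
    simp
  | _ + 1, A, V, L => by
    have ih := srcPull_srcμ A (V ⊗ L.1) L.2
    have hn := srcPull_naturality F (𝟙 (F.obj A)) (μ F V L.1) (Tuple.Hom.id L.2)
    have hμ := srcμ_naturality F (α_ A V L.1).hom (Tuple.Hom.id L.2)
    rw [id_tensorHom, id_tensorHom] at hn
    change (srcMap F (α_ (F.obj A) (F.obj V) (F.obj L.1)).hom (Tuple.Hom.id L.2) ≫
          srcPull F (F.obj A) (F.obj V ⊗ F.obj L.1) L.2) ≫
        F.obj A ◁ (srcMap F (μ F V L.1) (Tuple.Hom.id L.2) ≫ srcμ F (V ⊗ L.1) L.2) ≫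
          μ F A (src (𝟭 C) (V ⊗ L.1) L.2) =
      srcMap F (μ F A V ⊗ₘ F.map (𝟙 L.1)) (Tuple.Hom.id L.2) ≫
        (srcMap F (μ F (A ⊗ V) L.1) (Tuple.Hom.id L.2) ≫ srcμ F ((A ⊗ V) ⊗ L.1) L.2) ≫
          F.map (srcMap (𝟭 C) (α_ A V L.1).hom (Tuple.Hom.id L.2) ≫
            srcPull (𝟭 C) A (V ⊗ L.1) L.2)
    rw [F.map_comp, MonoidalCategory.whiskerLeft_comp]
    simp only [Category.assoc]
    rw [← reassoc_of% hn, ih, ← reassoc_of% hμ]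
    simp only [← Category.assoc, srcMap_comp, Tuple.Hom.comp_id, F.map_id, tensorHom_id]
    simp only [Category.assoc, Functor.LaxMonoidal.associativity]

theorem srcSnoc_srcμ : ∀ {n : ℕ} (V : C) (L : Tuple C (n + 1)),
    srcSnoc F (F.obj V) L ≫ srcμ F V (Tuple.init L) ▷ F.obj (Tuple.last L) ≫
        μ F (src (𝟭 C) V (Tuple.init L)) (Tuple.last L) =
      srcμ F V L ≫ F.map (srcSnoc (𝟭 C) V L)
  | 0, V, L => by
    change 𝟙 _ ≫ 𝟙 (F.obj V) ▷ F.obj L.1 ≫ μ F V L.1 = (μ F V L.1 ≫ 𝟙 _) ≫ F.map (𝟙 (V ⊗ L.1))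
    simp
  | _ + 1, V, L => by
    have ih := srcSnoc_srcμ (V ⊗ L.1) L.2
    have hn := srcSnoc_naturality F (μ F V L.1) (Tuple.Hom.id L.2)
    rw [Tuple.Hom.init_id, Tuple.Hom.last_id, F.map_id, tensorHom_id] at hn
    change srcSnoc F (F.obj V ⊗ F.obj L.1) L.2 ≫
        (srcMap F (μ F V L.1) (Tuple.Hom.id (Tuple.init L.2)) ≫
          srcμ F (V ⊗ L.1) (Tuple.init L.2)) ▷ F.obj (Tuple.last L.2) ≫
        μ F (src (𝟭 C) (V ⊗ L.1) (Tuple.init L.2)) (Tuple.last L.2) =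
      (srcMap F (μ F V L.1) (Tuple.Hom.id L.2) ≫ srcμ F (V ⊗ L.1) L.2) ≫
        F.map (srcSnoc (𝟭 C) (V ⊗ L.1) L.2)
    rw [comp_whiskerRight, Category.assoc, Category.assoc, ← ih, ← reassoc_of% hn]

end Source

/-! ### Transposing along a universal arrow -/

section Transpose

variable {C : Type u₁} [Category.{v₁} C] [MonoidalCategory C]
  {D : Type u₂} [Category.{v₂} D] [MonoidalCategory D] {F : C ⥤ D} [F.Monoidal]

/-- The morphism `F(V) ⊗ F(X₁) ⊗ … ⊗ F(Xₙ) ⟶ F(Y) ⊗ W` corresponding to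
`p : V ⊗ X₁ ⊗ … ⊗ Xₙ ⟶ Y ⊗ B` under `u : F(B) ⟶ W`. -/
def transpose {B : C} {W : D} (u : F.obj B ⟶ W) {V : C} {n : ℕ} {L : Tuple C n} {Y : C}
    (p : src (𝟭 C) V L ⟶ Y ⊗ B) : src F (F.obj V) L ⟶ F.obj Y ⊗ W :=
  srcμ F V L ≫ F.map p ≫ δ F Y B ≫ F.obj Y ◁ u

variable {B : C} {W : D} {u : F.obj B ⟶ W}

/-- Transposing is bijective, since `F(Y ⊗ B) ⟶ F(Y) ⊗ W` is universal when `Y` has a dual. -/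
theorem transpose_bijective (hu : IsUniversalArrow F u) (V : C) {n : ℕ} (L : Tuple C n) (Y : C)
    [HasRightDual Y] :
    Function.Bijective (transpose u : (src (𝟭 C) V L ⟶ Y ⊗ B) → _) := by
  change Function.Bijective fun p : src (𝟭 C) V L ⟶ Y ⊗ B =>
    srcμ F V L ≫ F.map p ≫ δ F Y B ≫ F.obj Y ◁ u
  convert ((asIso (srcμ F V L)).symm.homCongr (Iso.refl (F.obj Y ⊗ W))).bijective.comp
    (hu.whiskerLeft Y _) using 2 with p
  simp

theorem srcMap_transpose {V V' : C} {n : ℕ} {L M : Tuple C n} {Y : C} (a : V ⟶ V')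
    (φ : Tuple.Hom L M) (p : src (𝟭 C) V' M ⟶ Y ⊗ B) :
    srcMap F (F.map a) φ ≫ transpose u p = transpose u (srcMap (𝟭 C) a φ ≫ p) := by
  rw [transpose, transpose, ← Category.assoc, srcμ_naturality, F.map_comp]
  simp only [Category.assoc]

theorem transpose_comp {V : C} {n : ℕ} {L : Tuple C n} {Y Y' : C}
    (p : src (𝟭 C) V L ⟶ Y ⊗ B) (b : Y ⟶ Y') :
    transpose u p ≫ F.map b ▷ W = transpose u (p ≫ b ▷ B) := by
  simp only [transpose, Category.assoc, F.map_comp, whisker_exchange, δ_natural_left_assoc]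

theorem srcMerge_transpose {V : C} {n : ℕ} (j : Fin n) {L : Tuple C (n + 1)} {Y : C}
    (p : src (𝟭 C) V (merge j L) ⟶ Y ⊗ B) :
    srcMerge F j (F.obj V) L ≫ transpose u p = transpose u (srcMerge (𝟭 C) j V L ≫ p) := by
  rw [transpose, transpose, ← Category.assoc, srcMerge_srcμ, F.map_comp]
  simp only [Category.assoc]

/-- The universal arrow for `(X ⊗ Y) ⊗ B` agrees with that for `X ⊗ (Y ⊗ B)`. -/
theorem whiskerLeft_δ_comp_μ (u : F.obj B ⟶ W) (X Y : C) :
    F.obj X ◁ δ F Y B ≫ F.obj X ◁ F.obj Y ◁ u ≫ (α_ (F.obj X) (F.obj Y) W).inv ≫ μ F X Y ▷ W =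
      μ F X (Y ⊗ B) ≫ F.map (α_ X Y B).inv ≫ δ F (X ⊗ Y) B ≫ F.obj (X ⊗ Y) ◁ u := by
  rw [associator_inv_naturality_right_assoc, whisker_exchange,
    Functor.Monoidal.map_associator_inv_assoc]
  simp only [Functor.Monoidal.μ_δ_assoc]

/-- Transposing commutes with the first coface, for an arbitrary exchange morphism `b`. -/
theorem whiskerLeft_transpose {V X Y : C} {n : ℕ} {L : Tuple C n} (b : V ⊗ X ⟶ X ⊗ V)
    (p : src (𝟭 C) V L ⟶ Y ⊗ B) :
    srcMap F (μ F V X ≫ F.map b ≫ δ F X V) (Tuple.Hom.id L) ≫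
        srcPull F (F.obj X) (F.obj V) L ≫ F.obj X ◁ transpose u p ≫
          (α_ (F.obj X) (F.obj Y) W).inv ≫ μ F X Y ▷ W =
      srcMap F (μ F V X) (Tuple.Hom.id L) ≫
        transpose u (srcMap (𝟭 C) b (Tuple.Hom.id L) ≫ srcPull (𝟭 C) X V L ≫ X ◁ p ≫
          (α_ X Y B).inv) := by
  have h₁ := srcPull_srcμ F X V L
  have h₂ := srcμ_naturality F b (Tuple.Hom.id L)
  rw [← cancel_mono (δ F X (src (𝟭 C) V L))] at h₁
  simp only [Category.assoc, Functor.Monoidal.μ_δ, Category.comp_id] at h₁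
  simp only [transpose, MonoidalCategory.whiskerLeft_comp, Category.assoc]
  rw [reassoc_of% h₁, δ_natural_right_assoc, whiskerLeft_δ_comp_μ,
    Functor.Monoidal.δ_μ_assoc, F.map_comp, F.map_comp, F.map_comp]
  simp only [Category.assoc]
  rw [← reassoc_of% h₂]
  simp only [← Category.assoc, srcMap_comp, Tuple.Hom.comp_id]
  simp only [Category.assoc, Functor.Monoidal.δ_μ, Category.comp_id]

/-- Transposing commutes with the last coface if `u` intertwines the exchange morphisms `c`
and `d`. -/
theorem transpose_whiskerRight {V Y : C} {n : ℕ} {L : Tuple C (n + 1)}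
    (p : src (𝟭 C) V (Tuple.init L) ⟶ Y ⊗ B)
    {c : B ⊗ Tuple.last L ⟶ Tuple.last L ⊗ B}
    {d : W ⊗ F.obj (Tuple.last L) ⟶ F.obj (Tuple.last L) ⊗ W}
    (h : u ▷ F.obj (Tuple.last L) ≫ d = (μ F B _ ≫ F.map c ≫ δ F _ B) ≫ F.obj _ ◁ u) :
    srcSnoc F (F.obj V) L ≫ transpose u p ▷ F.obj (Tuple.last L) ≫
        (α_ (F.obj Y) W (F.obj (Tuple.last L))).hom ≫ F.obj Y ◁ d ≫
          (α_ (F.obj Y) (F.obj (Tuple.last L)) W).inv ≫ μ F Y (Tuple.last L) ▷ W =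
      transpose u (srcSnoc (𝟭 C) V L ≫ p ▷ Tuple.last L ≫ (α_ Y B (Tuple.last L)).hom ≫
        Y ◁ c ≫ (α_ Y (Tuple.last L) B).inv) := by
  have h₁ := srcSnoc_srcμ F V L
  have h₂ := congrArg (F.obj Y ◁ ·) h
  have h₃ : δ F Y B ▷ F.obj (Tuple.last L) ≫ (α_ (F.obj Y) (F.obj B) (F.obj (Tuple.last L))).hom ≫
      F.obj Y ◁ μ F B (Tuple.last L) ≫ μ F Y (B ⊗ Tuple.last L) =
        μ F (Y ⊗ B) (Tuple.last L) ≫ F.map (α_ Y B (Tuple.last L)).hom := by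
    rw [← Functor.LaxMonoidal.associativity, Functor.Monoidal.whiskerRight_δ_μ_assoc]
  simp only [MonoidalCategory.whiskerLeft_comp, Category.assoc] at h₂
  simp only [transpose, comp_whiskerRight, Category.assoc]
  rw [associator_naturality_middle_assoc, reassoc_of% h₂, whiskerLeft_δ_comp_μ,
    μ_natural_right_assoc, reassoc_of% h₃, μ_natural_left_assoc, reassoc_of% h₁]
  simp only [F.map_comp, Category.assoc]

end Transpose

/-! ### Isomorphisms of complexes -/

section Cohomology

/-- Isomorphic sequences of linear maps have isomorphic cohomology. -/
theorem nonempty_cohomology_equiv {k : Type*} [Field k] {M N : ℕ → Type*}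
    [∀ n, AddCommGroup (M n)] [∀ n, Module k (M n)] [∀ n, AddCommGroup (N n)]
    [∀ n, Module k (N n)] {d : ∀ n, M n →ₗ[k] M (n + 1)} {d' : ∀ n, N n →ₗ[k] N (n + 1)}
    (e : ∀ n, M n ≃ₗ[k] N n) (h : ∀ n x, e (n + 1) (d n x) = d' n (e n x)) (n : ℕ) :
    Nonempty (Cohomology d n ≃ₗ[k] Cohomology d' n) := by
  have hk : (LinearMap.ker (d n)).map (e n : M n →ₗ[k] N n) = LinearMap.ker (d' n) := by
    ext y
    obtain ⟨x, rfl⟩ := (e n).surjective y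
    simp [← h]
  have hb : (coboundaries d n).map (e n : M n →ₗ[k] N n) = coboundaries d' n := by
    cases n with
    | zero => simp [coboundaries]
    | succ n =>
      ext y
      simp only [coboundaries, Submodule.mem_map, LinearMap.mem_range, exists_exists_eq_and]
      constructor
      · rintro ⟨x, rfl⟩
        exact ⟨e n x, (h n x).symm⟩
      · rintro ⟨y, rfl⟩
        exact ⟨(e n).symm y, by simp [h]⟩
  refine ⟨Submodule.Quotient.equiv _ _ ((e n).ofSubmodules _ _ hk) ?_⟩
  ext ⟨y, hy⟩
  obtain ⟨x, rfl⟩ := (e n).surjective y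
  have hx : d' n (e n x) = 0 := hy
  change (∃ z : LinearMap.ker (d n), z.1 ∈ coboundaries d n ∧ _) ↔ e n x ∈ coboundaries d' n
  rw [← hb]
  constructor
  · rintro ⟨z, hz, hzx⟩
    exact ⟨z, hz, congrArg Subtype.val hzx⟩
  · rintro ⟨z, hz, hzx⟩
    have hz' : e n z = e n x := hzx
    refine ⟨⟨z, ?_⟩, hz, Subtype.ext hzx⟩
    rw [LinearMap.mem_ker, ← (e (n + 1)).map_eq_zero_iff, h, hz', hx]

variable {k : Type w} [Field k] {C : Type u₁} [Category.{v₁} C] [MonoidalCategory C]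
  {D : Type u₂} [Category.{v₂} D] [MonoidalCategory D] [Preadditive D] [Linear k D]
  [MonoidalPreadditive D] [MonoidalLinear k D] {F : C ⥤ D} [F.Monoidal]

/-- Linear bijections of cochains that commute with all cofaces induce isomorphisms on
cohomology. -/
theorem nonempty_cohomology_equiv_of_faces {C' : Type*} [Category* C'] [MonoidalCategory C']
    {D' : Type*} [Category* D'] [MonoidalCategory D'] [Preadditive D'] [Linear k D']
    [MonoidalPreadditive D'] [MonoidalLinear k D'] {F' : C' ⥤ D'} [F'.Monoidal]
    {V : D} {G : C ⥤ D} {V' : D'} {G' : C' ⥤ D'} (S : OuterData F V G) (S' : OuterData F' V' G')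
    (e : ∀ n, MultiNat k F V G n ≃ₗ[k] MultiNat k F' V' G' n)
    (hfirst : ∀ n f, e (n + 1) (firstFace S n f) = firstFace S' n (e n f))
    (hinner : ∀ n (j : Fin n) f, e (n + 1) (innerFace j f) = innerFace j (e n f))
    (hlast : ∀ n f, e (n + 1) (lastFace S n f) = lastFace S' n (e n f)) (n : ℕ) :
    Nonempty (Cohomology (M := fun n => MultiNat k F V G n) (differential S) n ≃ₗ[k]
      Cohomology (M := fun n => MultiNat k F' V' G' n) (differential S') n) :=
  nonempty_cohomology_equiv e (fun n f => by
    simp [differential, hfirst, hinner, hlast]) n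

/-- The natural transformations `V ⊗ F(X₁) ⊗ … ⊗ F(Xₙ) ⟶ G(X₁ ⊗ … ⊗ Xₙ)` depend on `V` and `G` only
up to isomorphism. -/
def multiNatCongr {V V' : D} {G G' : C ⥤ D} (a : V' ≅ V) (θ : G ≅ G') (n : ℕ) :
    MultiNat k F V G n ≃ₗ[k] MultiNat k F V' G' n where
  toFun f := ⟨fun L => srcMap F a.hom (Tuple.Hom.id L) ≫ f.1 L ≫ θ.hom.app (tens L),
    fun L M φ => by
      have h := MultiNat.naturality f φ
      simp only [Category.assoc, ← θ.hom.naturality]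
      rw [← reassoc_of% h]
      simp only [← Category.assoc, srcMap_comp, Tuple.Hom.id_comp, Tuple.Hom.comp_id,
        Category.id_comp, Category.comp_id]⟩
  invFun f := ⟨fun L => srcMap F a.inv (Tuple.Hom.id L) ≫ f.1 L ≫ θ.inv.app (tens L),
    fun L M φ => by
      have h := MultiNat.naturality f φ
      simp only [Category.assoc, ← θ.inv.naturality]
      rw [← reassoc_of% h]
      simp only [← Category.assoc, srcMap_comp, Tuple.Hom.id_comp, Tuple.Hom.comp_id,
        Category.id_comp, Category.comp_id]⟩
  left_inv f := by
    refine Subtype.ext (funext fun L => ?_)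
    simp only [Category.assoc, Iso.hom_inv_id_app, Category.comp_id]
    rw [← Category.assoc, srcMap_comp, a.inv_hom_id, Tuple.Hom.id_comp, srcMap_id,
      Category.id_comp]
  right_inv f := by
    refine Subtype.ext (funext fun L => ?_)
    simp only [Category.assoc, Iso.inv_hom_id_app, Category.comp_id]
    rw [← Category.assoc, srcMap_comp, a.hom_inv_id, Tuple.Hom.id_comp, srcMap_id,
      Category.id_comp]
  map_add' f g := by
    ext L
    simp [Preadditive.comp_add, Preadditive.add_comp]
  map_smul' c f := by
    ext L
    simp

/-- Isomorphisms `V' ≅ V` and `G ≅ G'` compatible with the structure maps of the outer cofaces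
induce isomorphisms on cohomology. -/
theorem nonempty_cohomology_equiv_of_iso {V V' : D} {G G' : C ⥤ D} (S : OuterData F V G)
    (S' : OuterData F V' G') (a : V' ≅ V) (θ : G ≅ G')
    (hswap : ∀ X, a.hom ▷ F.obj X ≫ S.swap X = S'.swap X ≫ F.obj X ◁ a.hom)
    (hleft : ∀ X Y, S.left X Y ≫ θ.hom.app (X ⊗ Y) = F.obj X ◁ θ.hom.app Y ≫ S'.left X Y)
    (hright : ∀ X Y, S.right X Y ≫ θ.hom.app (X ⊗ Y) = θ.hom.app X ▷ F.obj Y ≫ S'.right X Y)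
    (n : ℕ) :
    Nonempty (Cohomology (M := fun n => MultiNat k F V G n) (differential S) n ≃ₗ[k]
      Cohomology (M := fun n => MultiNat k F V' G' n) (differential S') n) := by
  refine nonempty_cohomology_equiv_of_faces S S' (multiNatCongr a θ) (fun n f => ?_)
    (fun n j f => ?_) (fun n f => ?_) n
  · refine Subtype.ext (funext fun L => ?_)
    have hn := srcPull_naturality F (𝟙 (F.obj L.1)) a.hom (Tuple.Hom.id L.2)
    change srcMap F (a.hom ⊗ₘ F.map (𝟙 L.1)) (Tuple.Hom.id L.2) ≫
        (srcMap F (S.swap L.1) (Tuple.Hom.id L.2) ≫ srcPull F (F.obj L.1) V L.2 ≫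
          F.obj L.1 ◁ f.1 L.2 ≫ S.left L.1 (tens L.2)) ≫ θ.hom.app (L.1 ⊗ tens L.2) =
      srcMap F (S'.swap L.1) (Tuple.Hom.id L.2) ≫ srcPull F (F.obj L.1) V' L.2 ≫
          F.obj L.1 ◁ (srcMap F a.hom (Tuple.Hom.id L.2) ≫ f.1 L.2 ≫ θ.hom.app (tens L.2)) ≫
            S'.left L.1 (tens L.2)
    rw [id_tensorHom, id_tensorHom] at hn
    simp only [Category.assoc, MonoidalCategory.whiskerLeft_comp]
    rw [hleft, ← reassoc_of% hn]
    simp only [← Category.assoc, srcMap_comp]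
    rw [F.map_id, tensorHom_id, hswap]
  · refine Subtype.ext (funext fun L => ?_)
    have hn := srcMerge_naturality F j a.hom (Tuple.Hom.id L)
    change srcMap F a.hom (Tuple.Hom.id L) ≫ (srcMerge F j V L ≫ f.1 (merge j L) ≫
        G.map (tensMerge j L)) ≫ θ.hom.app (tens L) =
      srcMerge F j V' L ≫ (srcMap F a.hom (Tuple.Hom.id (merge j L)) ≫ f.1 (merge j L) ≫
        θ.hom.app (tens (merge j L))) ≫ G'.map (tensMerge j L)
    rw [mergeHom_id] at hn
    simp only [Category.assoc, θ.hom.naturality]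
    rw [reassoc_of% hn]
  · refine Subtype.ext (funext fun L => ?_)
    have hn := srcSnoc_naturality F a.hom (Tuple.Hom.id L)
    change srcMap F a.hom (Tuple.Hom.id L) ≫ (srcSnoc F V L ≫
        f.1 (Tuple.init L) ▷ F.obj (Tuple.last L) ≫
          S.right (tens (Tuple.init L)) (Tuple.last L) ≫ G.map (tensSnoc L)) ≫
            θ.hom.app (tens L) =
      srcSnoc F V' L ≫ (srcMap F a.hom (Tuple.Hom.id (Tuple.init L)) ≫ f.1 (Tuple.init L) ≫
          θ.hom.app (tens (Tuple.init L))) ▷ F.obj (Tuple.last L) ≫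
        S'.right (tens (Tuple.init L)) (Tuple.last L) ≫ G'.map (tensSnoc L)
    rw [Tuple.Hom.init_id, Tuple.Hom.last_id, F.map_id, tensorHom_id] at hn
    simp only [Category.assoc, θ.hom.naturality, comp_whiskerRight]
    rw [reassoc_of% hn, reassoc_of% hright]

/-- Omitting the coefficients amounts to taking the tensor unit as both coefficients, the unit on
the left being `F̃(𝟙)`. -/
theorem nonempty_DYCohomology_equiv (n : ℕ) :
    Nonempty (DYCohomology k F n ≃ₗ[k]
      DYCohomologyCoeff k F ((Centralizer.lift F).obj (Centralizer.unit (𝟭 C)))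
        (Centralizer.unit F) n) := by
  let θ : F ≅ F ⋙ tensorRight (𝟙_ D) := NatIso.ofComponents (fun X => (ρ_ (F.obj X)).symm)
  refine nonempty_cohomology_equiv_of_iso (trivialOuterData F) (coeffOuterData _ _)
    (Functor.Monoidal.εIso F).symm θ
    (fun X => ?_) (fun X Y => ?_) (fun X Y => ?_) n
  · change η F ▷ F.obj X ≫ (λ_ (F.obj X)).hom ≫ (ρ_ (F.obj X)).inv =
      (μ F (𝟙_ C) X ≫ F.map ((λ_ X).hom ≫ (ρ_ X).inv) ≫ δ F X (𝟙_ C)) ≫ F.obj X ◁ η F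
    simp
  · change μ F X Y ≫ (ρ_ (F.obj (X ⊗ Y))).inv = F.obj X ◁ (ρ_ (F.obj Y)).inv ≫
      (α_ (F.obj X) (F.obj Y) (𝟙_ D)).inv ≫ μ F X Y ▷ 𝟙_ D
    rw [MonoidalCategory.rightUnitor_inv_naturality]
    monoidal
  · change μ F X Y ≫ (ρ_ (F.obj (X ⊗ Y))).inv = (ρ_ (F.obj X)).inv ▷ F.obj Y ≫
      (α_ (F.obj X) (𝟙_ D) (F.obj Y)).hom ≫ F.obj X ◁ ((λ_ (F.obj Y)).hom ≫ (ρ_ (F.obj Y)).inv) ≫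
        (α_ (F.obj X) (F.obj Y) (𝟙_ D)).inv ≫ μ F X Y ▷ 𝟙_ D
    rw [MonoidalCategory.rightUnitor_inv_naturality]
    monoidal

end Cohomology

/-! ### Comparison of Davydov–Yetter complexes -/

section Comparison

variable {k : Type w} [Field k]
  {C : Type u₁} [Category.{v₁} C] [MonoidalCategory C] [Preadditive C] [Linear k C]
  {D : Type u₂} [Category.{v₂} D] [MonoidalCategory D] [Preadditive D] [Linear k D]
  {F : C ⥤ D} [F.Monoidal]

theorem transpose_add [F.Additive] {B : C} {W : D} (u : F.obj B ⟶ W)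
    {V : C} {n : ℕ} {L : Tuple C n} {Y : C}
    (p q : src (𝟭 C) V L ⟶ Y ⊗ B) : transpose u (p + q) = transpose u p + transpose u q := by
  simp only [transpose, F.map_add, Preadditive.add_comp, Preadditive.comp_add]

theorem transpose_smul [F.Linear k] {B : C} {W : D} (u : F.obj B ⟶ W)
    {V : C} {n : ℕ} {L : Tuple C n} {Y : C}
    (c : k) (p : src (𝟭 C) V L ⟶ Y ⊗ B) : transpose u (c • p) = c • transpose u p := by
  simp only [transpose, F.map_smul, Linear.smul_comp, Linear.comp_smul]

variable [F.Additive] [F.Linear k]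

variable (k) in
/-- The linear map from the natural transformations `V ⊗ X₁ ⊗ … ⊗ Xₙ ⟶ X₁ ⊗ … ⊗ Xₙ ⊗ B` to the
natural transformations `F(V) ⊗ F(X₁) ⊗ … ⊗ F(Xₙ) ⟶ F(X₁ ⊗ … ⊗ Xₙ) ⊗ W` induced by a morphism
`u : F(B) ⟶ W`. -/
def multiNatTranspose {B : C} {W : D} (u : F.obj B ⟶ W) (V : C) (n : ℕ) :
    MultiNat k (𝟭 C) V (𝟭 C ⋙ tensorRight B) n →ₗ[k]
      MultiNat k F (F.obj V) (F ⋙ tensorRight W) n where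
  toFun g := ⟨fun L => transpose u (Y := tens L) (g.1 L), fun L M φ => by
    have h : srcMap (𝟭 C) (𝟙 V) φ ≫ g.1 M = g.1 L ≫ tensMap φ ▷ B := MultiNat.naturality g φ
    have h₁ := srcMap_transpose (u := u) (𝟙 V) φ (Y := tens M) (g.1 M)
    have h₂ := transpose_comp (u := u) (Y := tens L) (g.1 L) (tensMap φ)
    rw [F.map_id] at h₁
    exact h₁.trans ((congrArg _ h).trans h₂.symm)⟩
  map_add' f g := Subtype.ext (funext fun L => transpose_add u (f.1 L) (g.1 L))
  map_smul' c f := Subtype.ext (funext fun L => transpose_smul u c (f.1 L))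

/-- Transposing is bijective on natural families: a family with natural transpose is natural, since
both sides of the naturality condition have the same transpose. -/
theorem multiNatTranspose_bijective [RigidCategory C] {B : C} {W : D} {u : F.obj B ⟶ W}
    (hu : IsUniversalArrow F u) (V : C) (n : ℕ) :
    Function.Bijective (multiNatTranspose k u V n) := by
  constructor
  · intro f g h
    refine Subtype.ext (funext fun L => (transpose_bijective hu V L (tens L)).1 ?_)
    exact congrFun (congrArg Subtype.val h) L
  · intro f
    choose g hg using fun L => (transpose_bijective hu V L (tens L)).2 (f.1 L)
    refine ⟨⟨g, fun L M φ => (transpose_bijective hu V L (tens M)).1 ?_⟩,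
      Subtype.ext (funext hg)⟩
    have h₁ := srcMap_transpose (u := u) (𝟙 V) φ (g M)
    have h₂ := transpose_comp (u := u) (g L) (tensMap φ)
    rw [F.map_id, hg] at h₁
    rw [hg] at h₂
    exact h₁.symm.trans ((MultiNat.naturality f φ).trans h₂)

variable [MonoidalPreadditive D] [MonoidalLinear k D]

/-- A morphism `F̃(B) ⟶ W` of `𝒵(F)` that is a universal arrow on underlying objects identifies the
complexes with coefficients `F̃(V), W` and `V, B`. -/
theorem nonempty_DYCohomologyCoeff_lift_equiv [MonoidalPreadditive C] [MonoidalLinear k C]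
    [RigidCategory C] {B : Centralizer (𝟭 C)} {W : Centralizer F}
    (u : (Centralizer.lift F).obj B ⟶ W) (hu : IsUniversalArrow F u.hom)
    (V : Centralizer (𝟭 C)) (n : ℕ) :
    Nonempty (DYCohomologyCoeff k F ((Centralizer.lift F).obj V) W n ≃ₗ[k]
      DYCohomologyCoeff k (𝟭 C) V B n) := by
  refine Nonempty.map LinearEquiv.symm (nonempty_cohomology_equiv_of_faces
    (coeffOuterData V B) (coeffOuterData ((Centralizer.lift F).obj V) W)
    (fun n => LinearEquiv.ofBijective (multiNatTranspose k u.hom V.obj n)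
      (multiNatTranspose_bijective hu V.obj n)) (fun n g => ?_) (fun n j g => ?_)
    (fun n g => ?_) n)
  · refine Subtype.ext (funext fun L => ?_)
    -- The monoidal structure of `𝟭 C` is the identity by definition.
    change transpose u.hom (L := L) (Y := L.1 ⊗ tens L.2)
        (srcMap (𝟭 C) (W := L.1 ⊗ V.obj) (L := L.2) (M := L.2) (V.braid L.1).hom
          (Tuple.Hom.id L.2) ≫
          srcPull (𝟭 C) L.1 V.obj L.2 ≫
          L.1 ◁ g.1 L.2 ≫ (α_ L.1 (tens L.2) B.obj).inv ≫ 𝟙 (L.1 ⊗ tens L.2) ▷ B.obj) = _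
    rw [id_whiskerRight, Category.comp_id]
    exact (Category.assoc _ _ _).trans (whiskerLeft_transpose (u := u.hom) (L := L.2)
      (V.braid L.1).hom (Y := tens L.2) (g.1 L.2)).symm
  · refine Subtype.ext (funext fun L => ?_)
    have h₁ := srcMerge_transpose (u := u.hom) (V := V.obj) j (L := L) (Y := tens (merge j L))
      (g.1 (merge j L))
    have h₂ := transpose_comp (u := u.hom) (Y := tens (merge j L))
      (srcMerge (𝟭 C) j V.obj L ≫ g.1 (merge j L)) (tensMerge j L)
    rw [← h₁] at h₂
    exact (congrArg (transpose u.hom (Y := tens L)) (Category.assoc _ _ _).symm).trans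
      (h₂.symm.trans (Category.assoc _ _ _))
  · refine Subtype.ext (funext fun L => ?_)
    have h₁ := transpose_whiskerRight (u := u.hom) (V := V.obj) (L := L)
      (Y := tens (Tuple.init L)) (g.1 (Tuple.init L)) (u.comm (Tuple.last L))
    have h₂ := transpose_comp (u := u.hom) (srcSnoc (𝟭 C) V.obj L ≫
      g.1 (Tuple.init L) ▷ Tuple.last L ≫ (α_ (tens (Tuple.init L)) B.obj (Tuple.last L)).hom ≫
        tens (Tuple.init L) ◁ (B.braid (Tuple.last L)).hom ≫
          (α_ (tens (Tuple.init L)) (Tuple.last L) B.obj).inv) (tensSnoc L)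
    rw [← h₁] at h₂
    change transpose u.hom (L := L) (Y := tens L)
      (srcSnoc (𝟭 C) V.obj L ≫ g.1 (Tuple.init L) ▷ Tuple.last L ≫
        ((α_ (tens (Tuple.init L)) B.obj (Tuple.last L)).hom ≫
          tens (Tuple.init L) ◁ (B.braid (Tuple.last L)).hom ≫
            (α_ (tens (Tuple.init L)) (Tuple.last L) B.obj).inv ≫
              𝟙 (tens (Tuple.init L) ⊗ Tuple.last L) ▷ B.obj) ≫ tensSnoc L ▷ B.obj) =
      srcSnoc F (F.obj V.obj) L ≫
        (transpose u.hom (g.1 (Tuple.init L))) ▷ F.obj (Tuple.last L) ≫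
        ((α_ (F.obj (tens (Tuple.init L))) W.obj (F.obj (Tuple.last L))).hom ≫
          F.obj (tens (Tuple.init L)) ◁ (W.braid (Tuple.last L)).hom ≫
            (α_ (F.obj (tens (Tuple.init L))) (F.obj (Tuple.last L)) W.obj).inv ≫
              μ F (tens (Tuple.init L)) (Tuple.last L) ▷ W.obj) ≫ F.map (tensSnoc L) ▷ W.obj
    rw [id_whiskerRight, Category.comp_id]
    simp only [Category.assoc] at h₂ ⊢
    exact h₂.symm

end Comparison

end DavydovYetter

end

theorem mainTheorem1
    {k : Type w} [Field k]
    {C : Type u₁} [Category.{v₁} C] [Abelian C] [Linear k C] [MonoidalCategory C]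
    [MonoidalPreadditive C] [MonoidalLinear k C] [RigidCategory C]
    (hC : DavydovYetter.IsFiniteLinearCategory k C)
    {D : Type u₂} [Category.{v₂} D] [Abelian D] [Linear k D] [MonoidalCategory D]
    [MonoidalPreadditive D] [MonoidalLinear k D]
    [∀ X : D, PreservesFiniteColimits (tensorLeft X)]
    [∀ X : D, PreservesFiniteColimits (tensorRight X)]
    (F : C ⥤ D) [F.Additive] [F.Linear k] [F.Monoidal] [PreservesFiniteColimits F]
    (R : D ⥤ C) (adj : F ⊣ R) :
    (∃ (R' : DavydovYetter.Centralizer F ⥤ DavydovYetter.Centralizer (𝟭 C))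
      (adj' : DavydovYetter.Centralizer.lift F ⊣ R'),
      DavydovYetter.IsLiftedAdjunction adj adj') ∧
    ∀ (R' : DavydovYetter.Centralizer F ⥤ DavydovYetter.Centralizer (𝟭 C))
      (_ : DavydovYetter.Centralizer.lift F ⊣ R'),
      (∀ (V : DavydovYetter.Centralizer (𝟭 C)) (W : DavydovYetter.Centralizer F) (n : ℕ),
        Nonempty
          (DavydovYetter.DYCohomologyCoeff k F ((DavydovYetter.Centralizer.lift F).obj V) W n ≃ₗ[k]
            DavydovYetter.DYCohomologyCoeff k (𝟭 C) V (R'.obj W) n)) ∧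
      (∀ n : ℕ,
        Nonempty
          (DavydovYetter.DYCohomology k F n ≃ₗ[k]
            DavydovYetter.DYCohomologyCoeff k (𝟭 C) (DavydovYetter.Centralizer.unit (𝟭 C))
              (R'.obj (DavydovYetter.Centralizer.unit F)) n)) := by
  have key (R' : DavydovYetter.Centralizer F ⥤ DavydovYetter.Centralizer (𝟭 C))
      (adj' : DavydovYetter.Centralizer.lift F ⊣ R') (V : DavydovYetter.Centralizer (𝟭 C))
      (W : DavydovYetter.Centralizer F) (n : ℕ) :=
    DavydovYetter.nonempty_DYCohomologyCoeff_lift_equiv (k := k) (adj'.counit.app W)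
      (DavydovYetter.Centralizer.isUniversalArrow_counit_app adj' adj W) V n
  refine ⟨⟨_, _, DavydovYetter.Centralizer.isLiftedAdjunction_liftAdjunction adj⟩,
    fun R' adj' => ⟨key R' adj', fun n => ?_⟩⟩
  obtain ⟨e⟩ := DavydovYetter.nonempty_DYCohomology_equiv (k := k) (F := F) n
  obtain ⟨e'⟩ := key R' adj' (DavydovYetter.Centralizer.unit (𝟭 C))
    (DavydovYetter.Centralizer.unit F) n
  exact ⟨e.trans e'⟩
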